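/- **Conventions.** For $0\le q\le p\le 1$ and $k\le n$, $G(n,q)$ is the Erdős–Rényi random graph on $[n]$; $G(n,k,q)$ is $G(n,q)$ with a clique planted on a uniformly random $k$-subset of $[n]$; and $G(n,k,p,q)$ is the random graph on $[n]$ obtained by choosing a uniformly random $k$-subset $S$ and joining, independently, every two vertices of $S$ with probability $p$ and every other two vertices with probability $q$. $\mathrm{PC}_D(n,k,q)$ is the problem of testing $H_0: G\sim G(n,q)$ against $H_1: G\sim G(n,k,q)$, and $\mathrm{PDS}_D(n,k,p,q)$ is the problem of testing $H_0:G\sim G(n,q)$ against $H_1:G\sim G(n,k,p,q)$. The Type I$+$II error of a randomized test $A$ is $\mathbb P_{H_0}[A(G)=1]+\mathbb P_{H_1}[A(G)=0]$. A sequence of randomized polynomial-time tests $A_n$, taking graphs on $N_n$ vertices to $\{0,1\}$, is a sequence of programs for a random access machine with coin flips (unit-cost addition, truncated subtraction, test for zero, and memory access) such that the length of $A_n$ and its worst-case number of steps are bounded by a fixed polynomial in $N_n$; $A_n$ may otherwise depend on $n$ arbitrarily. **PC conjecture at density $1/2$.** For every sequence of randomized polynomial-time tests $A_n$ on graphs with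 $n$ vertices and every sequence of positive integers $k_n$ with $\limsup_{n\to\infty}\log_n k_n<\frac12$, the Type I$+$II errors $e_n$ of $A_n$ on $\mathrm{PC}_D(n,k_n,\frac12)$ satisfy $\liminf_{n\to\infty} e_n\ge 1$. **Parameter regime.** A sequence $(N_n,K_n,p_n,q_n)$ with $K_n\le N_n$ and $0\le q_n<p_n\le1$ is in the regime $q=\Theta(1)$, $p-q=\tilde\Theta(N^{-\alpha})$, $K=\tilde\Theta(N^\beta)$ if $N_n\to\infty$, $q_n$ is bounded below by a positive constant, and $$\lim_{n\to\infty}\frac{\log (p_n-q_n)^{-1}}{\log N_n}=\alpha,\qquad \lim_{n\to\infty}\frac{\log K_n}{\log N_n}=\beta .$$ **Theorem.** Let $\alpha\in[0,2)$ and $\beta\in(0,1)$. 1. If $\beta<\frac12+\frac\alpha2$, there is a sequence $(N_n,K_n,p_n,q_n)_{n\in\mathbb N}$ in this regime such that, assuming the PC conjecture at density $1/2$, for every sequence of randomized polynomial-time tests $\phi_n$ on graphs with $N_n$ vertices, the Type I$+$II errors $e_n$ of $\phi_n$ on $\mathrm{PDS}_D(N_n,K_n,p_n,q_n)$ satisfy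 $\liminf_{n\to\infty}e_n\ge1$ (in particular, the asymptotic Type I$+$II error $\limsup_{n\to\infty} e_n$ is at least $1$). 2. If $\beta>\frac12+\frac\alpha2$, then for every sequence $(N_n,K_n,p_n,q_n)_{n\in\mathbb N}$ in this regime there is a sequence of randomized polynomial-time tests whose Type I$+$II errors on $\mathrm{PDS}_D(N_n,K_n,p_n,q_n)$ tend to $0$. That is, the computational boundary for $\mathrm{PDS}_D$ in this regime is $\beta^*=\frac12+\frac\alpha2$. -/

import Mathlib

open Filter Topology MeasureTheory
open scoped ENNReal unitInterval

noncomputable section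

namespace PlantedDense

/-! ## Randomized algorithms: a random access machine with coin flips and a step count

The memory consists of arrays, named by natural numbers and indexed by two natural numbers, whose
entries are natural numbers. Unit-cost arithmetic is restricted to addition and truncated
subtraction, so `T` steps of a program of length `L` only create numbers with polynomially many
bits (in `T`, `L` and the size of the input), and the model is polynomially equivalent to
(probabilistic) Turing machines. -/

/-- A memory: `m a i j` is the entry `(i, j)` of the array `a`. -/
abbrev Mem := ℕ → ℕ → ℕ → ℕ

/-- Replace the entry `(i, j)` of the array `a` by `v`. -/
def Mem.write (m : Mem) (a i j v : ℕ) : Mem :=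
  fun a' i' j' => if a' = a ∧ i' = i ∧ j' = j then v else m a' i' j'

/-- Expressions: constants, array entries, sums and truncated differences. -/
inductive Expr : Type
  | lit (c : ℕ)
  | get (a : ℕ) (i j : Expr)
  | add (e f : Expr)
  | sub (e f : Expr)

/-- The value of an expression. -/
def Expr.eval (m : Mem) : Expr → ℕ
  | .lit c => c
  | .get a i j => m a (i.eval m) (j.eval m)
  | .add e f => e.eval m + f.eval m
  | .sub e f => e.eval m - f.eval m

/-- The length of an expression; constants and names are written in binary. -/
def Expr.length : Expr → ℕ
  | .lit c => Nat.size c + 1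
  | .get a i j => Nat.size a + i.length + j.length + 1
  | .add e f => e.length + f.length + 1
  | .sub e f => e.length + f.length + 1

/-- Programs. `set a i j e` writes `e` into the entry `(i, j)` of the array `a`; `flip a i j`
writes there a fresh uniformly random bit; `ite e c d` runs `c` if `e` is nonzero and `d`
otherwise; `loop e c` repeats `c` as long as `e` is nonzero. -/
inductive Prog : Type
  | skip
  | set (a : ℕ) (i j e : Expr)
  | flip (a : ℕ) (i j : Expr)
  | seq (c d : Prog)
  | ite (e : Expr) (c d : Prog)
  | loop (e : Expr) (c : Prog)

/-- The length of a program. -/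
def Prog.length : Prog → ℕ
  | .skip => 1
  | .set a i j e => Nat.size a + i.length + j.length + e.length + 1
  | .flip a i j => Nat.size a + i.length + j.length + 1
  | .seq c d => c.length + d.length + 1
  | .ite e c d => e.length + c.length + d.length + 1
  | .loop e c => e.length + c.length + 1

/-- A configuration: the list of programs that remain to be run, and the memory. -/
abbrev Config := List Prog × Mem

/-- One step of the machine. A configuration with nothing left to run is halted. -/
def step : Config → PMF Config
  | ([], m) => PMF.pure ([], m)
  | (.skip :: l, m) => PMF.pure (l, m)
  | (.set a i j e :: l, m) => PMF.pure (l, m.write a (i.eval m) (j.eval m) (e.eval m))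
  | (.flip a i j :: l, m) =>
      (PMF.uniformOfFintype Bool).map fun b =>
        (l, m.write a (i.eval m) (j.eval m) (if b then 1 else 0))
  | (.seq c d :: l, m) => PMF.pure (c :: d :: l, m)
  | (.ite e c d :: l, m) => PMF.pure ((if e.eval m ≠ 0 then c else d) :: l, m)
  | (.loop e c :: l, m) => PMF.pure (if e.eval m ≠ 0 then c :: .loop e c :: l else l, m)

/-- The law of the configuration after `T` steps. -/
def runFor : ℕ → Config → PMF Config
  | 0, x => PMF.pure x
  | T + 1, x => (step x).bind (runFor T)

open Classical in
/-- The input memory for a graph on `n` vertices: array `0` holds `n` in its entry `(0, 0)`,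
array `1` holds the adjacency matrix, and every other entry is `0`. -/
def inputMem {n : ℕ} (G : SimpleGraph (Fin n)) : Mem := fun a i j =>
  if a = 0 ∧ i = 0 ∧ j = 0 then n
  else if a = 1 ∧ ∃ (hi : i < n) (hj : j < n), G.Adj ⟨i, hi⟩ ⟨j, hj⟩ then 1
  else 0

/-- The answer of a halted program is read off the entry `(0, 0)` of the array `2`. -/
def answer (m : Mem) : Bool := decide (m 2 0 0 ≠ 0)

/-- The program `A` halts on the input `G` within `T` steps, whatever the coin flips are. -/
def HaltsWithin {n : ℕ} (A : Prog) (G : SimpleGraph (Fin n)) (T : ℕ) : Prop :=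
  ∀ x ∈ (runFor T ([A], inputMem G)).support, x.1 = []

/-- The probability, over the coin flips of `A`, that `A` halts on the input `G` and answers `b`.
(The events for the successive values of `T` increase.) -/
def outputProb {n : ℕ} (A : Prog) (G : SimpleGraph (Fin n)) (b : Bool) : ℝ≥0∞ :=
  ⨆ T : ℕ, (runFor T ([A], inputMem G)).toOuterMeasure {x | x.1 = [] ∧ answer x.2 = b}

/-- `A n`, `n ∈ ℕ`, is a sequence of randomized polynomial-time tests, the `n`-th of which takes
graphs on `N n` vertices: the running time, for all inputs and all coin flips, and the length of
the program are bounded by a polynomial in `N n`. (Without a bound on the length, programs with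
built-in lookup tables would decide everything.) -/
def IsPolyTime (N : ℕ → ℕ) (A : ℕ → Prog) : Prop :=
  ∃ P : Polynomial ℕ, ∀ n, (A n).length ≤ P.eval (N n) ∧
    ∀ G : SimpleGraph (Fin (N n)), HaltsWithin (A n) G (P.eval (N n))

/-! ## The random graphs -/

/-- The mixture of the laws `P S` over a uniformly random `S ⊆ [n]` of size `k` (for `k ≤ n`). -/
def uniformMixture (n k : ℕ) (P : Finset (Fin n) → Measure (SimpleGraph (Fin n))) :
    Measure (SimpleGraph (Fin n)) :=
  ((n.choose k : ℝ≥0∞)⁻¹) • ∑ S ∈ Finset.powersetCard k (Finset.univ : Finset (Fin n)), P S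

/-- The complete graph on the vertex set `S`. -/
def cliqueOn {n : ℕ} (S : Finset (Fin n)) : SimpleGraph (Fin n) where
  Adj i j := i ∈ S ∧ j ∈ S ∧ i ≠ j
  symm := ⟨fun _ _ h => ⟨h.2.1, h.1, h.2.2.symm⟩⟩
  loopless := ⟨fun _ h => h.2.2 rfl⟩

/-- The graph that has the edges of `A` inside `S` and the edges of `B` on all other pairs. -/
def splice {n : ℕ} (S : Finset (Fin n)) (A B : SimpleGraph (Fin n)) : SimpleGraph (Fin n) where
  Adj i j := (i ∈ S ∧ j ∈ S ∧ A.Adj i j) ∨ (¬ (i ∈ S ∧ j ∈ S) ∧ B.Adj i j)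
  symm := ⟨by
    rintro i j (⟨hi, hj, h⟩ | ⟨hS, h⟩)
    · exact Or.inl ⟨hj, hi, h.symm⟩
    · exact Or.inr ⟨fun h' => hS ⟨h'.2, h'.1⟩, h.symm⟩⟩
  loopless := ⟨by
    rintro i (⟨_, _, h⟩ | ⟨_, h⟩)
    · exact A.irrefl h
    · exact B.irrefl h⟩

/-- `G(n, p)`. -/
def erdosRenyi (n : ℕ) (p : I) : Measure (SimpleGraph (Fin n)) :=
  SimpleGraph.binomialRandom (Fin n) p

/-- `G(n, k, p)`: a sample of `G(n, p)` in which a clique is planted on a uniformly random set of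
`k` vertices. -/
def plantedClique (n k : ℕ) (p : I) : Measure (SimpleGraph (Fin n)) :=
  uniformMixture n k fun S => (erdosRenyi n p).map fun G => G ⊔ cliqueOn S

/-- `G(n, k, p, q)`: for a uniformly random set `S` of `k` vertices, any two vertices in `S` are
joined with probability `p` and any other two vertices with probability `q`, independently. -/
def plantedDense (n k : ℕ) (p q : I) : Measure (SimpleGraph (Fin n)) :=
  uniformMixture n k fun S =>
    ((erdosRenyi n p).prod (erdosRenyi n q)).map fun x => splice S x.1 x.2

/-! ## Detection problems -/

/-- The probability that `A` answers `b` on a random graph with law `μ`. -/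
def answerProb {n : ℕ} (A : Prog) (μ : Measure (SimpleGraph (Fin n))) (b : Bool) : ℝ≥0∞ :=
  open Classical in ∑ G : SimpleGraph (Fin n), μ {G} * outputProb A G b

/-- The Type I+II error of `A` as a test of the simple hypotheses `μ₀` against `μ₁`. -/
def testError {n : ℕ} (A : Prog) (μ₀ μ₁ : Measure (SimpleGraph (Fin n))) : ℝ≥0∞ :=
  answerProb A μ₀ true + answerProb A μ₁ false

/-- The Type I+II error of `A` on the planted clique detection problem with parameters
`n, k, p`. -/
def errorPC (n k : ℕ) (p : I) (A : Prog) : ℝ≥0∞ :=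
  testError A (erdosRenyi n p) (plantedClique n k p)

/-- The Type I+II error of `A` on the planted dense subgraph detection problem with parameters
`n, k, p, q`. -/
def errorPDS (n k : ℕ) (p q : I) (A : Prog) : ℝ≥0∞ :=
  testError A (erdosRenyi n q) (plantedDense n k p q)

/-- The planted clique conjecture with edge density `p`. -/
def PCConjecture (p : I) : Prop :=
  ∀ (A : ℕ → Prog) (k : ℕ → ℕ), IsPolyTime (fun n => n) A → (∀ n, 0 < k n) →
    limsup (fun n : ℕ => (Real.logb n (k n) : EReal)) atTop < ((1 / 2 : ℝ) : EReal) →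
    1 ≤ liminf (fun n => errorPC n (k n) p (A n)) atTop

/-- The edge density `1/2`. -/
def half : I := ⟨1 / 2, by norm_num, by norm_num⟩

/-- The parameter regime `q = Θ(1)`, `p - q = N ^ (-α + o(1))`, `K = N ^ (β + o(1))` as
`N → ∞`, for planted dense subgraphs with `p > q`. -/
structure DenseRegime (α β : ℝ) (N K : ℕ → ℕ) (p q : ℕ → I) : Prop where
  tendsto_N : Tendsto N atTop atTop
  K_le : ∀ n, K n ≤ N n
  q_lt_p : ∀ n, q n < p n
  q_theta : ∃ c : ℝ, 0 < c ∧ ∀ n, c ≤ (q n : ℝ)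
  signal : Tendsto (fun n => Real.log ((p n : ℝ) - q n)⁻¹ / Real.log (N n)) atTop (𝓝 α)
  sparsity : Tendsto (fun n => Real.log (K n) / Real.log (N n)) atTop (𝓝 β)

end PlantedDense

end

noncomputable section

namespace PlantedDense

/-! ## Running programs -/

/-! Above the boundary, counting edges is enough. Planting raises the mean edge count by `(p - q) *
K.choose 2`, while its standard deviation is at most `N`, so a threshold halfway between the two
means errs with probability O(N² / ((p - q)² K⁴)) by Chebyshev. This tends to zero because 2 + 2α -
4β < 0 (`errorPDS_countProg_le`).

Below the boundary, planted clique on n vertices with clique size k = n^κ, κ < 1/2, is reduced to a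
planted dense subgraph on N = M m vertices with K = k m, q = 1/2, p = 1/2 + δ, where M is of order
n. Every vertex becomes a group of m vertices and every bit of the adjacency matrix a block of at
most m² bits. The block law must send a uniform bit to exactly uniform bits and the bit 1 to nearly
independent bits of mean p. This is possible when m δ is at most about 1 / log n: the likelihood
ratio of biased to uniform bits then rarely exceeds 2, and a law Q ≤ 2U for the bit 1 leaves the law
2U - Q for the bit 0 (`exists_kernel`, `one_sub_le_sum_min`, `LiftKernel.sum_bitsProb_law_le`).

Pairs inside one group need a diagonal bit, which a graph lacks, and which must be 1 on the clique
without revealing it. So the graph is placed at random positions in a larger symmetric matrix of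
uniform bits, among the indices whose diagonal bit is 1. About M / 2 indices qualify, and a change
of measure shows that the result is close to a uniform matrix with a random k × k minor, diagonal
included, set to 1 (`exists_embedBits_reduction`).

The test may depend on n arbitrarily, so all randomness of the reduction (positions, padding,
blocks, vertex labels) is fixed at values that do no worse than average, up to a small error. What
remains is a map under which each adjacency is constant, an adjacency of the input or a
non-adjacency of it, and such a map is a straight-line program of polynomial length
(`IsLocal.exists_prog`). No block law is ever sampled by the machine.

The strict inequality β < 1/2 + α/2 is what leaves room for exponents of m, δ and k with κ < 1/2
(`exists_exponents`). -/

lemma runFor_halted (T : ℕ) (m : Mem) : runFor T ([], m) = PMF.pure ([], m) := by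
  induction T with
  | zero => rfl
  | succ T ih => simp [runFor, step, ih]

lemma mem_support_runFor_succ {T : ℕ} {x : Config}
    (h : ∀ y ∈ (runFor T x).support, y.1 = []) :
    ∀ y ∈ (runFor (T + 1) x).support, y.1 = [] := by
  induction T generalizing x with
  | zero =>
    obtain ⟨l, m⟩ := x
    have hl : l = [] := h (l, m) (by simp [runFor])
    subst hl
    intro y hy
    rw [runFor_halted] at hy
    simp only [PMF.support_pure, Set.mem_singleton_iff] at hy
    simp [hy]
  | succ T ih =>
    intro y hy
    rw [runFor, PMF.mem_support_bind_iff] at hy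
    obtain ⟨z, hz, hy⟩ := hy
    refine ih (fun w hw => h w ?_) y hy
    rw [runFor, PMF.mem_support_bind_iff]
    exact ⟨z, hz, hw⟩

lemma HaltsWithin.mono {n : ℕ} {A : Prog} {G : SimpleGraph (Fin n)} {T T' : ℕ}
    (h : HaltsWithin A G T) (hT : T ≤ T') : HaltsWithin A G T' := by
  induction hT with
  | refl => exact h
  | step _ ih => exact mem_support_runFor_succ ih

/-- Halted configurations are absorbing. Hence the supremum over running times may start at any
time, which absorbs the cost of preprocessing. -/
lemma runFor_halts_mono (x : Config) (b : Bool) :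
    Monotone fun T => (runFor T x).toOuterMeasure {x | x.1 = [] ∧ answer x.2 = b} := by
  refine monotone_nat_of_le_succ fun T => ?_
  induction T generalizing x with
  | zero =>
    obtain ⟨l, m⟩ := x
    rcases eq_or_ne l [] with rfl | hl
    · simp only [runFor_halted]; exact le_rfl
    · simp [runFor, hl]
  | succ T ih =>
    rw [runFor, runFor, PMF.toOuterMeasure_bind_apply, PMF.toOuterMeasure_bind_apply]
    exact ENNReal.tsum_le_tsum fun a => mul_le_mul_right (ih a) _

lemma outputProb_le_one {n : ℕ} (A : Prog) (G : SimpleGraph (Fin n)) (b : Bool) :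
    outputProb A G b ≤ 1 := by
  refine iSup_le fun T => ?_
  rw [PMF.toOuterMeasure_apply]
  calc _ ≤ ∑' x, (runFor T ([A], inputMem G)) x :=
        ENNReal.tsum_le_tsum fun x => Set.indicator_le_self _ _ x
    _ = 1 := PMF.tsum_coe _

lemma outputProb_eq_shift {n : ℕ} (A : Prog) (G : SimpleGraph (Fin n)) (b : Bool) (T₀ : ℕ) :
    outputProb A G b = ⨆ T : ℕ,
      (runFor (T + T₀) ([A], inputMem G)).toOuterMeasure {x | x.1 = [] ∧ answer x.2 = b} :=
  ((runFor_halts_mono ([A], inputMem G) b).iSup_nat_add T₀).symm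

/-! ## Lists of assignments -/

/-- An assignment: write the value of `e` into the entry `(i, j)` of the array `a`. -/
structure Assignment where
  a : ℕ
  i : Expr
  j : Expr
  e : Expr

/-- The assignment as a program. -/
def Assignment.toProg (s : Assignment) : Prog := .set s.a s.i s.j s.e

/-- The effect of the assignment. -/
def Assignment.run (m : Mem) (s : Assignment) : Mem := m.write s.a (s.i.eval m) (s.j.eval m) (s.e.eval m)

/-- Carry out a list of assignments and continue with the program `c`. -/
def assigns : List Assignment → Prog → Prog
  | [], c => c
  | s :: l, c => .seq s.toProg (assigns l c)

/-- Each assignment costs two steps, one to unfold `seq` and one to execute `set`. No coin is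
flipped, so the laws agree exactly. -/
lemma runFor_assigns (L : List Assignment) (c : Prog) (l : List Prog) (m : Mem) (T : ℕ) :
    runFor (T + 2 * L.length) (assigns L c :: l, m) =
      runFor T (c :: l, L.foldl Assignment.run m) := by
  induction L generalizing m with
  | nil => rfl
  | cons s L ih =>
    have : T + 2 * (s :: L).length = (T + 2 * L.length) + 1 + 1 := by simp; ring
    rw [this, runFor, assigns]
    simp only [step, PMF.pure_bind]
    rw [runFor, Assignment.toProg]
    simp only [step, PMF.pure_bind]
    rw [ih]
    rfl

lemma length_assigns_le {B : ℕ} {L : List Assignment} (c : Prog)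
    (h : ∀ s ∈ L, s.toProg.length ≤ B) :
    (assigns L c).length ≤ L.length * (B + 1) + c.length := by
  induction L with
  | nil => simp [assigns]
  | cons s L ih =>
    have h1 := h s (by simp)
    have h2 := ih fun s hs => h s (by simp [hs])
    simp only [assigns, Prog.length, List.length_cons]
    nlinarith

lemma outputProb_assigns {n N : ℕ} {L : List Assignment} {A : Prog} {G : SimpleGraph (Fin n)}
    {H : SimpleGraph (Fin N)} (h : L.foldl Assignment.run (inputMem G) = inputMem H) (b : Bool) :
    outputProb (assigns L A) G b = outputProb A H b := by
  rw [outputProb_eq_shift _ _ _ (2 * L.length)]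
  simp only [runFor_assigns, h]
  rfl

lemma haltsWithin_assigns {n N : ℕ} {L : List Assignment} {A : Prog} {G : SimpleGraph (Fin n)}
    {H : SimpleGraph (Fin N)} (h : L.foldl Assignment.run (inputMem G) = inputMem H) {T : ℕ}
    (hA : HaltsWithin A H T) : HaltsWithin (assigns L A) G (T + 2 * L.length) := by
  rw [HaltsWithin, runFor_assigns, h]
  exact hA

lemma runFor_assigns_skip {n : ℕ} (L : List Assignment) (G : SimpleGraph (Fin n)) (T : ℕ) :
    runFor (T + (1 + 2 * L.length)) ([assigns L .skip], inputMem G) =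
      PMF.pure ([], L.foldl Assignment.run (inputMem G)) := by
  rw [← add_assoc, runFor_assigns, runFor]
  simp [step, runFor_halted]

lemma outputProb_assigns_skip {n : ℕ} (L : List Assignment) (G : SimpleGraph (Fin n)) (b : Bool) :
    outputProb (assigns L .skip) G b =
      if answer (L.foldl Assignment.run (inputMem G)) = b then 1 else 0 := by
  rw [outputProb_eq_shift _ _ _ (1 + 2 * L.length)]
  simp only [runFor_assigns_skip, PMF.toOuterMeasure_pure_apply]
  simp

lemma haltsWithin_assigns_skip {n : ℕ} (L : List Assignment) (G : SimpleGraph (Fin n)) :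
    HaltsWithin (assigns L .skip) G (1 + 2 * L.length) := by
  intro x hx
  have := runFor_assigns_skip L G 0
  rw [zero_add] at this
  rw [this] at hx
  simp only [PMF.support_pure, Set.mem_singleton_iff] at hx
  simp [hx]

/-! ## Filling an array -/

/-- The pairs of natural numbers below `R`. -/
def pairs (R : ℕ) : List (ℕ × ℕ) := (List.range R).product (List.range R)

lemma mem_pairs {R : ℕ} {x : ℕ × ℕ} : x ∈ pairs R ↔ x.1 < R ∧ x.2 < R := by
  obtain ⟨i, j⟩ := x
  simp [pairs]

lemma length_pairs (R : ℕ) : (pairs R).length = R * R := by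
  exact (List.length_product _ _).trans (by simp)

/-- Write the values of `e` into the array `a`, for all indices below `R`. -/
def fill (R a : ℕ) (e : ℕ → ℕ → Expr) : List Assignment :=
  (pairs R).map fun x => ⟨a, .lit x.1, .lit x.2, e x.1 x.2⟩

/-- The expressions may read only arrays other than `a`, so entries already overwritten do not
influence later ones. -/
lemma foldl_fill (R a : ℕ) (e : ℕ → ℕ → Expr) (v : ℕ → ℕ → ℕ) (m : Mem)
    (h : ∀ m' : Mem, (∀ a' ≠ a, m' a' = m a') → ∀ i j, (e i j).eval m' = v i j) :
    (fill R a e).foldl Assignment.run m =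
      fun a' i j => if a' = a ∧ i < R ∧ j < R then v i j else m a' i j := by
  suffices H : ∀ (L : List (ℕ × ℕ)) (m' : Mem), (∀ a' ≠ a, m' a' = m a') →
      (L.map fun x => (⟨a, .lit x.1, .lit x.2, e x.1 x.2⟩ : Assignment)).foldl Assignment.run m' =
        fun a' i j => if a' = a ∧ (i, j) ∈ L then v i j else m' a' i j by
    rw [fill, H _ m fun _ _ => rfl]
    simp only [mem_pairs]
  intro L
  induction L with
  | nil => intro m' _; simp
  | cons x L ih =>
    intro m' hm'
    obtain ⟨i₀, j₀⟩ := x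
    simp only [List.map_cons, List.foldl_cons]
    rw [ih]
    · funext a' i j
      simp only [Assignment.run, Mem.write, Expr.eval, List.mem_cons, Prod.mk.injEq, h m' hm']
      by_cases h1 : a' = a <;> by_cases h2 : (i, j) ∈ L <;> by_cases h3 : i = i₀ ∧ j = j₀ <;>
        simp_all
    · intro a' ha'
      rw [← hm' a' ha']
      funext i j
      simp [Assignment.run, Mem.write, ha']

/-! ## Local maps between graphs are computed by short programs -/

/-- Every adjacency of `F G` is constant, an adjacency of `G`, or a non-adjacency of `G`. -/
def IsLocal {n N : ℕ} (F : SimpleGraph (Fin n) → SimpleGraph (Fin N)) : Prop :=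
  ∀ i j : Fin N, (∃ c : Prop, ∀ G, (F G).Adj i j ↔ c) ∨
    (∃ u v : Fin n, ∀ G, (F G).Adj i j ↔ G.Adj u v) ∨
    (∃ u v : Fin n, ∀ G, (F G).Adj i j ↔ ¬ G.Adj u v)

open Classical in
lemma inputMem_one {n : ℕ} (G : SimpleGraph (Fin n)) (u v : Fin n) :
    inputMem G 1 u v = if G.Adj u v then 1 else 0 := by
  simp [inputMem]

lemma size_le_self (c : ℕ) : Nat.size c ≤ c := Nat.size_le.2 Nat.lt_two_pow_self

-- A non-adjacency is computed as the truncated difference of 1 and a matrix entry. Indices range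
-- over all of ℕ, with value 0 outside the matrix.
open Classical in
lemma IsLocal.exists_expr {n N : ℕ} {F : SimpleGraph (Fin n) → SimpleGraph (Fin N)}
    (hF : IsLocal F) (i j : ℕ) : ∃ e : Expr, e.length ≤ 2 * n + 10 ∧
      ∀ (G : SimpleGraph (Fin n)) (m : Mem), m 1 = inputMem G 1 →
        e.eval m = if ∃ (hi : i < N) (hj : j < N), (F G).Adj ⟨i, hi⟩ ⟨j, hj⟩ then 1 else 0 := by
  have hs0 : Nat.size 0 = 0 := by simp
  have hs1 : Nat.size 1 = 1 := by simp
  by_cases hij : i < N ∧ j < N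
  · obtain ⟨hi, hj⟩ := hij
    rcases hF ⟨i, hi⟩ ⟨j, hj⟩ with ⟨c, hc⟩ | ⟨u, v, h⟩ | ⟨u, v, h⟩
    · by_cases h : c
      · refine ⟨.lit 1, ?_, fun G m _ => ?_⟩
        · simp only [Expr.length, hs1]; omega
        · simp [Expr.eval, hi, hj, hc, h]
      · refine ⟨.lit 0, ?_, fun G m _ => ?_⟩
        · simp only [Expr.length, hs0]; omega
        · simp [Expr.eval, hi, hj, hc, h]
    · refine ⟨.get 1 (.lit u) (.lit v), ?_, fun G m hm => ?_⟩
      · have := size_le_self u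
        have := size_le_self v
        simp only [Expr.length, hs1]; omega
      · simp only [Expr.eval, hm, inputMem_one, hi, hj, h]
        simp
    · refine ⟨.sub (.lit 1) (.get 1 (.lit u) (.lit v)), ?_, fun G m hm => ?_⟩
      · have := size_le_self u
        have := size_le_self v
        simp only [Expr.length, hs1]; omega
      · simp only [Expr.eval, hm, inputMem_one, hi, hj, h]
        by_cases hG : G.Adj u v <;> simp [hG]
  · refine ⟨.lit 0, ?_, fun G m _ => ?_⟩
    · simp only [Expr.length, hs0]; omega
    · rw [if_neg]
      · rfl
      · rintro ⟨hi, hj, _⟩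
        exact hij ⟨hi, hj⟩

/-- The new matrix cannot be written directly over array 1, whose entries are still to be read. It
is built in array 3 and copied; then array 3 is cleared and the vertex count updated, so that the
memory is literally the input memory of `F G`. Since `n ≤ N`, the copy covers the whole old matrix.
-/
lemma IsLocal.exists_prog {n N : ℕ} {F : SimpleGraph (Fin n) → SimpleGraph (Fin N)}
    (hF : IsLocal F) (hnN : n ≤ N) (A : Prog) : ∃ A' : Prog,
      A'.length ≤ A.length + 100 * (N + 1) ^ 3 ∧
      (∀ (G : SimpleGraph (Fin n)) T, HaltsWithin A (F G) T →
        HaltsWithin A' G (T + 100 * (N + 1) ^ 3)) ∧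
      ∀ G b, outputProb A' G b = outputProb A (F G) b := by
  classical
  choose e he hev using fun i j => hF.exists_expr i j
  set L : List Assignment := fill N 3 e ++ (fill N 1 (fun i j => .get 3 (.lit i) (.lit j)) ++
    (fill N 3 (fun _ _ => .lit 0) ++ [⟨0, .lit 0, .lit 0, .lit N⟩])) with hL
  have hsz : ∀ c < N, Nat.size c ≤ N := fun c hc => (size_le_self c).trans hc.le
  have hszN := size_le_self N
  have hs0 : Nat.size 0 = 0 := by simp
  have hs1 : Nat.size 1 = 1 := by simp
  have hs3 : Nat.size 3 = 2 := by decide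
  have hlen : L.length = 3 * (N * N) + 1 := by
    simp [hL, fill, length_pairs]; ring
  have hB : ∀ s ∈ L, s.toProg.length ≤ 4 * N + 20 := by
    intro s hs
    simp only [hL, fill, List.mem_append, List.mem_map, List.mem_singleton, Prod.exists,
      mem_pairs] at hs
    rcases hs with ⟨i, j, ⟨hi, hj⟩, rfl⟩ | ⟨i, j, ⟨hi, hj⟩, rfl⟩ | ⟨i, j, ⟨hi, hj⟩, rfl⟩ | rfl
    · have := he i j
      have := hsz i hi
      have := hsz j hj
      simp only [Assignment.toProg, Prog.length, Expr.length, hs3]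
      omega
    · have := hsz i hi
      have := hsz j hj
      simp only [Assignment.toProg, Prog.length, Expr.length, hs3, hs1]
      omega
    · have := hsz i hi
      have := hsz j hj
      simp only [Assignment.toProg, Prog.length, Expr.length, hs3, hs0]
      omega
    · simp only [Assignment.toProg, Prog.length, Expr.length, hs0]
      omega
  have hrun : ∀ G, L.foldl Assignment.run (inputMem G) = inputMem (F G) := by
    intro G
    rw [hL, List.foldl_append, foldl_fill N 3 e _ (inputMem G) (fun m' hm' i j =>
      hev i j G m' (hm' 1 (by norm_num))), List.foldl_append, foldl_fill N 1 _
      (fun i j => if i < N ∧ j < N then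
        (if ∃ (hi : i < N) (hj : j < N), (F G).Adj ⟨i, hi⟩ ⟨j, hj⟩ then 1 else 0)
        else 0) _ ?_, List.foldl_append, foldl_fill N 3 _ (fun _ _ => 0) _ ?_]
    · funext a i j
      simp only [List.foldl_cons, List.foldl_nil, Assignment.run, Mem.write, Expr.eval, inputMem]
      by_cases ha0 : a = 0
      · subst ha0
        by_cases h : i = 0 ∧ j = 0 <;> simp [h]
      by_cases ha3 : a = 3
      · subst ha3
        by_cases h : i < N ∧ j < N
        · simp [h]
        · have : ¬ ∃ (hi : i < N) (hj : j < N), (F G).Adj ⟨i, hi⟩ ⟨j, hj⟩ := by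
            rintro ⟨hi, hj, _⟩
            exact h ⟨hi, hj⟩
          simp [h]
      by_cases ha1 : a = 1
      · subst ha1
        by_cases hij : i < N ∧ j < N
        · simp [hij]
        · have h1 : ¬ ∃ (hi : i < n) (hj : j < n), G.Adj ⟨i, hi⟩ ⟨j, hj⟩ := by
            rintro ⟨hi, hj, _⟩
            exact hij ⟨hi.trans_le hnN, hj.trans_le hnN⟩
          have h2 : ¬ ∃ (hi : i < N) (hj : j < N), (F G).Adj ⟨i, hi⟩ ⟨j, hj⟩ := by
            rintro ⟨hi, hj, _⟩
            exact hij ⟨hi, hj⟩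
          simp [hij, h1, h2]
      · simp [ha0, ha1, ha3]
    · intro m' _ i j
      rfl
    · intro m' hm' i j
      simp only [Expr.eval, hm' 3 (by norm_num)]
      by_cases hij : i < N ∧ j < N
      · simp [hij]
      · simp [hij, inputMem]
  have hp : (3 * (N * N) + 1) * (4 * N + 20 + 1) ≤ 100 * (N + 1) ^ 3 := by nlinarith [sq_nonneg N]
  refine ⟨assigns L A, ?_, fun G T hT => ?_, fun G b => outputProb_assigns (hrun G) b⟩
  · have := length_assigns_le A hB
    rw [hlen] at this
    omega
  · refine (haltsWithin_assigns (hrun G) hT).mono ?_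
    have : 2 * (3 * (N * N) + 1) ≤ (3 * (N * N) + 1) * (4 * N + 20 + 1) := by
      rw [mul_comm]; gcongr; omega
    rw [hlen]
    omega

/-! ## Product weights -/

lemma one_sub_sum_le_prod {Z : Type*} [DecidableEq Z] (s : Finset Z) (f : Z → ℝ) (h0 : ∀ z, 0 ≤ f z) (h1 : ∀ z, f z ≤ 1) :
    1 - ∑ z ∈ s, f z ≤ ∏ z ∈ s, (1 - f z) := by
  induction s using Finset.induction_on with
  | empty => simp
  | insert a s ha ih =>
    rw [Finset.sum_insert ha, Finset.prod_insert ha]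
    have hs : 0 ≤ ∑ z ∈ s, f z := Finset.sum_nonneg fun z _ => h0 z
    nlinarith [h0 a, h1 a, mul_nonneg (h0 a) hs,
      mul_le_mul_of_nonneg_left ih (sub_nonneg.2 (h1 a))]

section ProductWeights

variable {Z : Type*} [Fintype Z] [DecidableEq Z] {X : Z → Type*} [∀ z, Fintype (X z)]

lemma sum_prod_eq (κ : ∀ z, X z → ℝ) : ∑ x : ∀ z, X z, ∏ z, κ z (x z) = ∏ z, ∑ y, κ z y :=
  (Fintype.prod_sum κ).symm

lemma sum_prod_eq_one {κ : ∀ z, X z → ℝ} (h : ∀ z, ∑ y, κ z y = 1) :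
    ∑ x : ∀ z, X z, ∏ z, κ z (x z) = 1 := by
  simp [sum_prod_eq, h]

/-- Exchange the coordinates outside of `P` of two families. -/
def exchange {Z : Type*} {X : Z → Type*} (P : Z → Prop) [DecidablePred P] (x : (∀ z, X z) × (∀ z, X z)) :
    (∀ z, X z) × (∀ z, X z) :=
  (fun z => if P z then x.1 z else x.2 z, fun z => if P z then x.2 z else x.1 z)

lemma exchange_involutive {Z : Type*} {X : Z → Type*} (P : Z → Prop) [DecidablePred P] :
    Function.Involutive (exchange (X := X) P) := by
  rintro ⟨a, b⟩
  ext z <;> by_cases h : P z <;> simp [exchange, h]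

/-- Coordinates chosen from two independent families are independent. -/
lemma sum_sum_mix (P : Z → Prop) [DecidablePred P] {κ κ' : ∀ z, X z → ℝ}
    (h : ∀ z, ∑ y, κ z y = 1) (h' : ∀ z, ∑ y, κ' z y = 1) (F : (∀ z, X z) → ℝ) :
    ∑ a : ∀ z, X z, ∑ b : ∀ z, X z, (∏ z, κ z (a z)) * (∏ z, κ' z (b z)) *
        F (fun z => if P z then a z else b z) =
      ∑ x : ∀ z, X z, (∏ z, if P z then κ z (x z) else κ' z (x z)) * F x := by
  have h2 : ∑ y : ∀ z, X z, (∏ z, if P z then κ' z (y z) else κ z (y z)) = 1 := by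
    apply sum_prod_eq_one (κ := fun z y => if P z then κ' z y else κ z y)
    intro z
    by_cases hz : P z <;> simp [hz, h, h']
  rw [← Fintype.sum_prod_type' (f := fun (a b : ∀ z, X z) => (∏ z, κ z (a z)) * (∏ z, κ' z (b z)) *
        F (fun z => if P z then a z else b z)),
    -- Exchanging coordinates outside `P` puts the selected family in the first component; the
    -- second then carries a probability weight and sums out.
    Fintype.sum_equiv (exchange_involutive P).toPerm _ (fun x => (∏ z, if P z then κ z (x.1 z) else κ' z (x.1 z)) *
      (∏ z, if P z then κ' z (x.2 z) else κ z (x.2 z)) * F x.1)]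
  · rw [Fintype.sum_prod_type]
    refine Finset.sum_congr rfl fun x _ => ?_
    simp only
    rw [← Finset.sum_mul, ← Finset.mul_sum, h2, mul_one]
  · rintro ⟨a, b⟩
    change _ = (∏ z, if P z then κ z ((exchange P (a, b)).1 z) else κ' z ((exchange P (a, b)).1 z)) *
      (∏ z, if P z then κ' z ((exchange P (a, b)).2 z) else κ z ((exchange P (a, b)).2 z)) *
        F (exchange P (a, b)).1
    simp only [exchange]
    rw [← Finset.prod_mul_distrib, ← Finset.prod_mul_distrib]
    congr 1
    refine Finset.prod_congr rfl fun z _ => ?_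
    by_cases hz : P z <;> simp [hz, mul_comm]

end ProductWeights

section Fibers

variable {E Z : Type*} [Fintype E] [DecidableEq E] [Fintype Z] [DecidableEq Z]

/-- A function is the same as its restrictions to the fibers of a map. -/
def fiberEquiv (blk : E → Z) (Y : Type*) : (E → Y) ≃ ∀ z, {e // blk e = z} → Y where
  toFun h z e := h e
  invFun g e := g (blk e) ⟨e, rfl⟩
  left_inv _ := rfl
  right_inv g := by
    funext z ⟨e, he⟩
    subst he
    rfl

lemma sum_prod_fibers (blk : E → Z) (F : ∀ z, ({e // blk e = z} → Bool) → ℝ) :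
    ∑ h : E → Bool, ∏ z, F z (fun e => h e) = ∏ z, ∑ g, F z g := by
  rw [← sum_prod_eq, ← Fintype.sum_equiv (fiberEquiv blk Bool)]
  intro h
  rfl

end Fibers

/-! ## Independent random bits -/

/-- The probability that a random bit with mean `ρ` takes the value `b`. -/
def bern (ρ : ℝ) (b : Bool) : ℝ := if b then ρ else 1 - ρ

@[simp] lemma sum_bern (ρ : ℝ) : ∑ b, bern ρ b = 1 := by simp [bern]

lemma bern_nonneg {ρ : ℝ} (h0 : 0 ≤ ρ) (h1 : ρ ≤ 1) (b : Bool) : 0 ≤ bern ρ b := by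
  cases b <;> simp [bern, h0, h1]

lemma bern_half (b : Bool) : bern (1 / 2) b = 1 / 2 := by
  cases b <;> norm_num [bern]

section Bits

/-- The probability that independent random bits with means `ρ e` take the values `f e`. -/
def bitsProb {E : Type*} [Fintype E] (ρ : E → ℝ) (f : E → Bool) : ℝ := ∏ e, bern (ρ e) (f e)

lemma bitsProb_nonneg {E : Type*} [Fintype E] {ρ : E → ℝ} (h : ∀ e, ρ e ∈ Set.Icc 0 1) (f : E → Bool) :
    0 ≤ bitsProb ρ f := Finset.prod_nonneg fun e _ => bern_nonneg (h e).1 (h e).2 _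

variable {E : Type*} [Fintype E] [DecidableEq E]

lemma sum_bitsProb (ρ : E → ℝ) : ∑ f, bitsProb ρ f = 1 :=
  sum_prod_eq_one (κ := fun e => bern (ρ e)) fun _ => sum_bern _

lemma sum_bitsProb_mul_prod (ρ : E → ℝ) (φ : E → Bool → ℝ) :
    ∑ f, bitsProb ρ f * ∏ e, φ e (f e) = ∏ e, ∑ b, bern (ρ e) b * φ e b := by
  rw [← sum_prod_eq]
  simp [bitsProb, Finset.prod_mul_distrib]

/-- Bits that are chosen from two independent families are independent. -/
lemma sum_sum_bitsProb (P : E → Prop) [DecidablePred P] (ρ ρ' : E → ℝ) (F : (E → Bool) → ℝ) :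
    ∑ a, ∑ b, bitsProb ρ a * bitsProb ρ' b * F (fun e => if P e then a e else b e) =
      ∑ f, bitsProb (fun e => if P e then ρ e else ρ' e) f * F f := by
  unfold bitsProb
  rw [sum_sum_mix P (κ := fun e => bern (ρ e)) (κ' := fun e => bern (ρ' e))
    (fun _ => sum_bern _) (fun _ => sum_bern _) F]
  refine Finset.sum_congr rfl fun f _ => ?_
  congr 1
  refine Finset.prod_congr rfl fun e _ => ?_
  by_cases h : P e <;> simp [h]

/-- The value of a bit as a real number. -/
def bit (b : Bool) : ℝ := if b then 1 else 0

/-- A product of centred bits is a product over all coordinates with factor 1 elsewhere, so the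
expectation factorises and any coordinate occurring once contributes 0. -/
lemma sum_bitsProb_cov (ρ : E → ℝ) (e e' : E) :
    ∑ f, bitsProb ρ f * ((bit (f e) - ρ e) * (bit (f e') - ρ e')) =
      if e = e' then ρ e * (1 - ρ e) else 0 := by
  have h : ∀ f : E → Bool, (bit (f e) - ρ e) * (bit (f e') - ρ e') =
      ∏ x, ((if x = e then bit (f x) - ρ x else 1) * (if x = e' then bit (f x) - ρ x else 1)) := by
    intro f
    rw [Finset.prod_mul_distrib, Fintype.prod_ite_eq', Fintype.prod_ite_eq']
  simp_rw [h]
  rw [sum_bitsProb_mul_prod ρ fun x b =>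
    (if x = e then bit b - ρ x else 1) * (if x = e' then bit b - ρ x else 1)]
  split_ifs with hee
  · subst hee
    rw [Finset.prod_eq_single e]
    · simp [bern, bit]; ring
    · intro x _ hx
      simp [hx, bern]
    · simp
  · apply Finset.prod_eq_zero (Finset.mem_univ e)
    simp [hee, bern, bit]
    ring

lemma sum_bitsProb_sq (ρ : E → ℝ) (S : Finset E) :
    ∑ f, bitsProb ρ f * (∑ e ∈ S, (bit (f e) - ρ e)) ^ 2 = ∑ e ∈ S, ρ e * (1 - ρ e) := by
  simp_rw [sq, Finset.sum_mul_sum, Finset.mul_sum]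
  rw [Finset.sum_comm]
  refine Finset.sum_congr rfl fun e he => ?_
  rw [Finset.sum_comm]
  simp_rw [sum_bitsProb_cov]
  simp [he]

open Classical in
/-- Chebyshev's inequality for a sum of independent bits. -/
lemma sum_bitsProb_le_div {ρ : E → ℝ} (h : ∀ e, ρ e ∈ Set.Icc 0 1) (S : Finset E) {t : ℝ}
    (ht : 0 < t) :
    ∑ f, bitsProb ρ f * (if t ≤ |∑ e ∈ S, (bit (f e) - ρ e)| then 1 else 0) ≤
      S.card / (4 * t ^ 2) := by
  rw [le_div_iff₀ (by positivity), Finset.sum_mul]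
  calc _ ≤ ∑ f, 4 * (bitsProb ρ f * (∑ e ∈ S, (bit (f e) - ρ e)) ^ 2) := by
        refine Finset.sum_le_sum fun f _ => ?_
        have h0 := bitsProb_nonneg h f
        split_ifs with ht'
        · have := sq_abs (∑ e ∈ S, (bit (f e) - ρ e))
          have h2 : t ^ 2 ≤ (∑ e ∈ S, (bit (f e) - ρ e)) ^ 2 := by
            rw [← this]; gcongr
          nlinarith [mul_le_mul_of_nonneg_left h2 h0]
        · simp only [mul_zero, zero_mul]
          positivity
    _ = 4 * ∑ e ∈ S, ρ e * (1 - ρ e) := by rw [← Finset.mul_sum, sum_bitsProb_sq]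
    _ ≤ 4 * ∑ e ∈ S, (1 / 4 : ℝ) := by
        gcongr with e he
        nlinarith [sq_nonneg (ρ e - 1 / 2)]
    _ = S.card := by simp; ring

end Bits

/-! ## The laws of the random graphs -/

instance instMeasurableSingletonClassSimpleGraph (n : ℕ) :
    MeasurableSingletonClass (SimpleGraph (Fin n)) where
  measurableSet_singleton G := by
    have : ({G} : Set (SimpleGraph (Fin n))) = SimpleGraph.edgeSet ⁻¹' {G.edgeSet} := by
      ext H
      simp
    rw [this]
    exact SimpleGraph.measurable_edgeSet (measurableSet_singleton _)

instance instIsProbabilityMeasureErdosRenyi (n : ℕ) (p : I) :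
    IsProbabilityMeasure (erdosRenyi n p) := by
  unfold erdosRenyi
  infer_instance

/-- The graph whose adjacencies are given by bits; the bits on the diagonal are ignored. -/
def bitGraph {V : Type*} (f : Sym2 V → Bool) : SimpleGraph V where
  Adj x y := x ≠ y ∧ f s(x, y) = true
  symm := ⟨fun x y h => ⟨h.1.symm, by rw [Sym2.eq_swap]; exact h.2⟩⟩
  loopless := ⟨fun _ h => h.1 rfl⟩

lemma mem_edgeSet_bitGraph {V : Type*} (f : Sym2 V → Bool) (e : Sym2 V) :
    e ∈ (bitGraph f).edgeSet ↔ ¬ e.IsDiag ∧ f e = true := by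
  induction e with
  | _ x y => simp [bitGraph]

lemma bitGraph_eq_iff {V : Type*} (f : Sym2 V → Bool) (G : SimpleGraph V) :
    bitGraph f = G ↔ ∀ e : Sym2 V, ¬ e.IsDiag → (f e = true ↔ e ∈ G.edgeSet) := by
  rw [← SimpleGraph.edgeSet_inj, Set.ext_iff]
  refine forall_congr' fun e => ?_
  rw [mem_edgeSet_bitGraph]
  constructor
  · intro h he
    simpa [he] using h
  · intro h
    by_cases he : e.IsDiag
    · simp only [he, not_true_eq_false, false_and, false_iff]
      exact fun h' => SimpleGraph.not_isDiag_of_mem_edgeSet _ h' he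
    · simpa [he] using h he

lemma real_erdosRenyi_singleton (n : ℕ) (p : I) (G : SimpleGraph (Fin n)) :
    (erdosRenyi n p).real {G} =
      (p : ℝ) ^ G.edgeSet.ncard * (1 - p : ℝ) ^ (n.choose 2 - G.edgeSet.ncard) := by
  simp [erdosRenyi, measureReal_def]

open Classical in
lemma prod_edges_eq {n : ℕ} (p : ℝ) (G : SimpleGraph (Fin n)) :
    ∏ e : Sym2 (Fin n) with ¬ e.IsDiag, (if e ∈ G.edgeSet then p else 1 - p) =
      p ^ G.edgeSet.ncard * (1 - p) ^ (n.choose 2 - G.edgeSet.ncard) := by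
  have h1 : (Finset.univ.filter fun e : Sym2 (Fin n) => ¬ e.IsDiag).card = n.choose 2 := by
    have := Sym2.card_diagSet_compl (α := Fin n)
    rw [Fintype.card_fin] at this
    rw [← this, Fintype.card_subtype]
    congr 1
  have h2 : ((Finset.univ.filter fun e : Sym2 (Fin n) => ¬ e.IsDiag).filter
      (· ∈ G.edgeSet)).card = G.edgeSet.ncard := by
    rw [Set.ncard_eq_toFinset_card']
    congr 1
    ext e
    simp only [Finset.mem_filter, Finset.mem_univ, true_and, Set.mem_toFinset]
    exact ⟨fun h => h.2, fun h => ⟨SimpleGraph.not_isDiag_of_mem_edgeSet _ h, h⟩⟩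
  rw [Finset.prod_ite, Finset.prod_const, Finset.prod_const, h2]
  congr 2
  rw [← h1, ← h2, ← Finset.card_filter_add_card_filter_not
    (s := Finset.univ.filter fun e : Sym2 (Fin n) => ¬ e.IsDiag) (· ∈ G.edgeSet)]
  omega

-- The index set `Z` may exceed the set of pairs: bits not used by `j` integrate to 1. With
-- `Sym2.map ι` for `j`, this reads the random graph off part of a larger matrix of bits.
open Classical in
lemma integral_erdosRenyi {n : ℕ} {Z : Type*} [Fintype Z] [DecidableEq Z] (p : I)
    (j : Sym2 (Fin n) → Z) (hj : Set.InjOn j {e | ¬ e.IsDiag}) (F : SimpleGraph (Fin n) → ℝ) :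
    ∫ G, F G ∂(erdosRenyi n p) =
      ∑ a : Z → Bool, bitsProb (fun _ => (p : ℝ)) a * F (bitGraph (a ∘ j)) := by
  rw [integral_fintype .of_finite]
  have h1 : ∀ a : Z → Bool, bitsProb (fun _ => (p : ℝ)) a * F (bitGraph (a ∘ j)) =
      ∑ G, bitsProb (fun _ => (p : ℝ)) a * (if bitGraph (a ∘ j) = G then 1 else 0) * F G := by
    intro a
    simp
  simp_rw [h1]
  rw [Finset.sum_comm]
  refine Finset.sum_congr rfl fun G _ => ?_
  rw [← Finset.sum_mul, smul_eq_mul]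
  congr 1
  -- The event `bitGraph (a ∘ j) = G` constrains each bit separately, so its indicator is a product
  -- over `Z`.
  set φ : Z → Bool → ℝ := fun z b =>
    if ∃ e : Sym2 (Fin n), ¬ e.IsDiag ∧ j e = z ∧ ¬ (b = true ↔ e ∈ G.edgeSet) then 0 else 1 with hφ
  have h2 : ∀ a : Z → Bool, (if bitGraph (a ∘ j) = G then (1 : ℝ) else 0) = ∏ z, φ z (a z) := by
    intro a
    rw [bitGraph_eq_iff]
    split_ifs with h
    · symm
      apply Finset.prod_eq_one
      intro z _
      rw [hφ]
      simp only
      rw [if_neg]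
      rintro ⟨e, he, rfl, h'⟩
      exact h' (h e he)
    · push Not at h
      obtain ⟨e, he, h'⟩ := h
      symm
      apply Finset.prod_eq_zero (Finset.mem_univ (j e))
      rw [hφ]
      simp only
      rw [if_pos]
      refine ⟨e, he, rfl, ?_⟩
      simp only [Function.comp] at h'
      tauto
  simp_rw [h2]
  rw [sum_bitsProb_mul_prod, real_erdosRenyi_singleton, ← prod_edges_eq]
  rw [← Finset.prod_subset (Finset.subset_univ
    ((Finset.univ.filter fun e : Sym2 (Fin n) => ¬ e.IsDiag).image j)), Finset.prod_image]
  · refine Finset.prod_congr rfl fun e he => ?_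
    simp only [Finset.mem_filter, Finset.mem_univ, true_and] at he
    have h3 : ∀ b : Bool, φ (j e) b = if (b = true ↔ e ∈ G.edgeSet) then 1 else 0 := by
      intro b
      rw [hφ]
      simp only
      by_cases hb : (b = true ↔ e ∈ G.edgeSet)
      · rw [if_pos hb, if_neg]
        rintro ⟨e', he', hee, h'⟩
        rw [hj he' he hee] at h'
        exact h' hb
      · rw [if_neg hb, if_pos]
        exact ⟨e, he, rfl, hb⟩
    simp only [Fintype.sum_bool, h3, bern]
    by_cases he' : e ∈ G.edgeSet <;> simp [he']
  · intro e he e' he'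
    simp only [Finset.coe_filter, Finset.mem_univ, true_and] at he he'
    exact hj he he'
  · intro z _ hz
    have h3 : ∀ b : Bool, φ z b = 1 := by
      intro b
      rw [hφ]
      simp only
      rw [if_neg]
      rintro ⟨e, he, rfl, _⟩
      exact hz (Finset.mem_image_of_mem j (by simpa using he))
    simp [h3, bern]

lemma integral_uniformMixture {n : ℕ} (k : ℕ) (P : Finset (Fin n) → Measure (SimpleGraph (Fin n)))
    [∀ S, IsFiniteMeasure (P S)] (F : SimpleGraph (Fin n) → ℝ) :
    ∫ G, F G ∂(uniformMixture n k P) =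
      (n.choose k : ℝ)⁻¹ * ∑ S ∈ Finset.powersetCard k Finset.univ, ∫ G, F G ∂(P S) := by
  rw [uniformMixture, integral_smul_measure, integral_finsetSum_measure fun _ _ => .of_finite]
  simp

lemma integral_plantedClique {n : ℕ} (k : ℕ) (p : I) (F : SimpleGraph (Fin n) → ℝ) :
    ∫ G, F G ∂(plantedClique n k p) =
      (n.choose k : ℝ)⁻¹ * ∑ S ∈ Finset.powersetCard k Finset.univ,
        ∫ G, F (G ⊔ cliqueOn S) ∂(erdosRenyi n p) := by
  rw [plantedClique, integral_uniformMixture]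
  congr 1
  refine Finset.sum_congr rfl fun S _ => ?_
  exact integral_map (by exact Measurable.of_discrete.aemeasurable) (by exact .of_discrete)

open Classical in
/-- The edge probabilities of a planted dense subgraph on the vertex set `S`. -/
def denseProb {V : Type*} (p q : ℝ) (S : Finset V) (e : Sym2 V) : ℝ :=
  if ∀ v ∈ e, v ∈ S then p else q

/-- Splicing two independent graphs selects each bit from one of two independent families, which
gives independent bits with edge-dependent means. -/
lemma integral_plantedDense {n : ℕ} (k : ℕ) (p q : I) (F : SimpleGraph (Fin n) → ℝ) :
    ∫ G, F G ∂(plantedDense n k p q) =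
      (n.choose k : ℝ)⁻¹ * ∑ S ∈ Finset.powersetCard k Finset.univ,
        ∑ f, bitsProb (denseProb p q S) f * F (bitGraph f) := by
  rw [plantedDense, integral_uniformMixture]
  congr 1
  refine Finset.sum_congr rfl fun S _ => ?_
  rw [integral_map (by exact Measurable.of_discrete.aemeasurable) (by exact .of_discrete),
    integral_prod _ .of_finite, integral_erdosRenyi p id Function.injective_id.injOn]
  simp_rw [integral_erdosRenyi q id Function.injective_id.injOn, Finset.mul_sum]
  unfold denseProb
  rw [← @sum_sum_bitsProb _ _ _ (fun e : Sym2 (Fin n) => ∀ v ∈ e, v ∈ S)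
    (fun _ => Classical.propDecidable _) (fun _ => (p : ℝ)) (fun _ => (q : ℝ))
    fun f => F (bitGraph f)]
  refine Finset.sum_congr rfl fun a _ => Finset.sum_congr rfl fun b _ => ?_
  rw [← mul_assoc]
  congr 2
  ext x y
  simp only [splice, bitGraph, Function.comp, id, Sym2.mem_iff, forall_eq_or_imp, forall_eq]
  by_cases h : x ∈ S ∧ y ∈ S
  · simp [h]
  · rw [if_neg h]
    tauto

lemma denseProb_self {V : Type*} (q : ℝ) (S : Finset V) : denseProb q q S = fun _ => q := by
  funext e
  simp [denseProb]

lemma isFiniteMeasure_uniformMixture {n : ℕ} (k : ℕ)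
    (P : Finset (Fin n) → Measure (SimpleGraph (Fin n))) [∀ S, IsProbabilityMeasure (P S)] :
    IsFiniteMeasure (uniformMixture n k P) where
  measure_univ_lt_top := by
    simp only [uniformMixture, Measure.smul_apply, Measure.coe_finsetSum, Finset.sum_apply,
      measure_univ, Finset.sum_const, Finset.card_powersetCard, Finset.card_univ,
      Fintype.card_fin, nsmul_eq_mul, mul_one, smul_eq_mul]
    exact (ENNReal.inv_mul_le_one _).trans_lt ENNReal.one_lt_top

instance instIsFiniteMeasurePlantedClique (n k : ℕ) (p : I) :
    IsFiniteMeasure (plantedClique n k p) := by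
  have : ∀ S : Finset (Fin n), IsProbabilityMeasure
      ((erdosRenyi n p).map fun G => G ⊔ cliqueOn S) :=
    fun S => Measure.isProbabilityMeasure_map (by exact Measurable.of_discrete.aemeasurable)
  exact isFiniteMeasure_uniformMixture k _

instance instIsFiniteMeasurePlantedDense (n k : ℕ) (p q : I) :
    IsFiniteMeasure (plantedDense n k p q) := by
  have : ∀ S : Finset (Fin n), IsProbabilityMeasure
      (((erdosRenyi n p).prod (erdosRenyi n q)).map fun x => splice S x.1 x.2) :=
    fun S => Measure.isProbabilityMeasure_map (by exact Measurable.of_discrete.aemeasurable)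
  exact isFiniteMeasure_uniformMixture k _

/-- The probability that `A` answers `b` on the input `G`, as a real number. -/
def outputReal {n : ℕ} (A : Prog) (b : Bool) (G : SimpleGraph (Fin n)) : ℝ :=
  (outputProb A G b).toReal

lemma outputReal_nonneg {n : ℕ} (A : Prog) (b : Bool) (G : SimpleGraph (Fin n)) :
    0 ≤ outputReal A b G := ENNReal.toReal_nonneg

lemma outputReal_le_one {n : ℕ} (A : Prog) (b : Bool) (G : SimpleGraph (Fin n)) :
    outputReal A b G ≤ 1 := by
  have := ENNReal.toReal_mono ENNReal.one_ne_top (outputProb_le_one A G b)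
  simpa [outputReal] using this

lemma answerProb_eq {n : ℕ} (A : Prog) (μ : Measure (SimpleGraph (Fin n))) [IsFiniteMeasure μ]
    (b : Bool) : answerProb A μ b = ENNReal.ofReal (∫ G, outputReal A b G ∂μ) := by
  classical
  rw [integral_fintype .of_finite]
  simp_rw [smul_eq_mul]
  rw [ENNReal.ofReal_sum_of_nonneg fun G _ =>
    mul_nonneg measureReal_nonneg (outputReal_nonneg A b G)]
  unfold answerProb
  refine Finset.sum_congr (by congr!) fun G _ => ?_
  rw [ENNReal.ofReal_mul measureReal_nonneg, measureReal_def,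
    ENNReal.ofReal_toReal (measure_ne_top μ _), outputReal, ENNReal.ofReal_toReal]
  exact ((outputProb_le_one A G b).trans_lt ENNReal.one_lt_top).ne

lemma testError_eq {n : ℕ} (A : Prog) (μ₀ μ₁ : Measure (SimpleGraph (Fin n))) [IsFiniteMeasure μ₀]
    [IsFiniteMeasure μ₁] : testError A μ₀ μ₁ =
      ENNReal.ofReal (∫ G, outputReal A true G ∂μ₀ + ∫ G, outputReal A false G ∂μ₁) := by
  rw [testError, answerProb_eq, answerProb_eq, ENNReal.ofReal_add] <;>
  exact integral_nonneg fun G => outputReal_nonneg _ _ _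

/-! ## Counting edges -/

lemma sum_map_pairs (R : ℕ) (f : ℕ × ℕ → ℕ) :
    ((pairs R).map f).sum = ∑ i : Fin R, ∑ j : Fin R, f (i, j) := by
  have hnd : (pairs R).Nodup := List.Nodup.product List.nodup_range List.nodup_range
  have h : (pairs R).toFinset = Finset.range R ×ˢ Finset.range R := by
    ext x
    simp [mem_pairs]
  rw [← List.sum_toFinset f hnd, h, Finset.sum_product, Finset.sum_range]
  refine Finset.sum_congr rfl fun i _ => ?_
  rw [Finset.sum_range]

/-- Add up the entries of the adjacency matrix in the entry `(0, 0)` of the array `3`. -/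
def addEntries (L : List (ℕ × ℕ)) : List Assignment :=
  L.map fun x => ⟨3, .lit 0, .lit 0, .add (.get 3 (.lit 0) (.lit 0)) (.get 1 (.lit x.1) (.lit x.2))⟩

lemma foldl_addEntries (L : List (ℕ × ℕ)) (m : Mem) :
    (addEntries L).foldl Assignment.run m =
      m.write 3 0 0 (m 3 0 0 + (L.map fun x => m 1 x.1 x.2).sum) := by
  induction L generalizing m with
  | nil =>
    funext a i j
    simp only [addEntries, List.map_nil, List.foldl_nil, Mem.write, List.sum_nil, add_zero]
    split_ifs with h
    · rw [h.1, h.2.1, h.2.2]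
    · rfl
  | cons x L ih =>
    simp only [addEntries, List.map_cons, List.foldl_cons] at ih ⊢
    rw [ih]
    funext a i j
    simp only [Assignment.run, Mem.write, Expr.eval, List.sum_cons]
    by_cases h : a = 3 ∧ i = 0 ∧ j = 0
    · simp [h, add_assoc]
    · simp [h]

/-- The program that tests whether a graph on `N` vertices has more than `τ` edges. -/
def countProg (N τ : ℕ) : Prog :=
  assigns (addEntries (pairs N) ++
    -- Every edge occurs twice in the matrix, hence `2 * τ`; the truncated difference is nonzero
    -- exactly above the threshold.
    [⟨2, .lit 0, .lit 0, .sub (.get 3 (.lit 0) (.lit 0)) (.lit (2 * τ))⟩]) .skip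

lemma length_countProg (N τ : ℕ) :
    (countProg N τ).length ≤ (N * N + 1) * (2 * N + 2 * τ + 21) + 1 := by
  have hs0 : Nat.size 0 = 0 := by simp
  have hs1 : Nat.size 1 = 1 := by simp
  have hs2 : Nat.size 2 = 2 := by decide
  have hs3 : Nat.size 3 = 2 := by decide
  refine (length_assigns_le (B := 2 * N + 2 * τ + 20) .skip ?_).trans ?_
  · intro s hs
    simp only [addEntries, List.mem_append, List.mem_map, List.mem_singleton, Prod.exists,
      mem_pairs] at hs
    rcases hs with ⟨i, j, ⟨hi, hj⟩, rfl⟩ | rfl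
    · have := size_le_self i
      have := size_le_self j
      simp only [Assignment.toProg, Prog.length, Expr.length, hs3, hs1, hs0]
      omega
    · have := size_le_self (2 * τ)
      simp only [Assignment.toProg, Prog.length, Expr.length, hs3, hs2, hs0]
      omega
  · simp [addEntries, length_pairs, Prog.length]

lemma haltsWithin_countProg {N : ℕ} (τ : ℕ) (G : SimpleGraph (Fin N)) :
    HaltsWithin (countProg N τ) G (2 * (N * N) + 3) := by
  refine (haltsWithin_assigns_skip _ G).mono ?_
  simp [addEntries, length_pairs]
  omega

lemma sum_inputMem_one {N : ℕ} (G : SimpleGraph (Fin N)) :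
    ∑ i : Fin N, ∑ j : Fin N, inputMem G 1 i j = 2 * G.edgeSet.ncard := by
  classical
  rw [Set.ncard_eq_toFinset_card', ← SimpleGraph.edgeFinset, ← G.sum_degrees_eq_twice_card_edges]
  refine Finset.sum_congr rfl fun i _ => ?_
  simp_rw [inputMem_one]
  rw [Finset.sum_boole, ← G.card_neighborFinset_eq_degree, G.neighborFinset_eq_filter]
  rfl

lemma outputReal_countProg {N : ℕ} (τ : ℕ) (G : SimpleGraph (Fin N)) (b : Bool) :
    outputReal (countProg N τ) b G = if decide (τ < G.edgeSet.ncard) = b then 1 else 0 := by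
  have h : answer ((addEntries (pairs N) ++
      [(⟨2, .lit 0, .lit 0, .sub (.get 3 (.lit 0) (.lit 0)) (.lit (2 * τ))⟩ : Assignment)]).foldl
        Assignment.run (inputMem G)) = decide (τ < G.edgeSet.ncard) := by
    rw [List.foldl_append, foldl_addEntries, sum_map_pairs]
    simp only [sum_inputMem_one, List.foldl_cons, List.foldl_nil, answer]
    have h3 : inputMem G 3 0 0 = 0 := by simp [inputMem]
    simp only [Assignment.run, Mem.write, Expr.eval, h3]
    simp only [and_self, if_true]
    congr 1
    apply propext
    omega
  rw [outputReal, countProg, outputProb_assigns_skip, h]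
  split_ifs <;> simp

/-- The pairs of distinct elements. -/
def offDiagPairs (V : Type*) [Fintype V] [DecidableEq V] : Finset (Sym2 V) :=
  Finset.univ.filter fun e => ¬ e.IsDiag

open Classical in
lemma ncard_edgeSet_bitGraph {N : ℕ} (f : Sym2 (Fin N) → Bool) :
    ((bitGraph f).edgeSet.ncard : ℝ) = ∑ e ∈ offDiagPairs (Fin N), bit (f e) := by
  rw [Set.ncard_eq_toFinset_card']
  unfold bit offDiagPairs
  rw [Finset.sum_boole, Finset.filter_filter]
  congr 2
  ext e
  simp [mem_edgeSet_bitGraph]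

lemma filter_subset_eq_image {V : Type*} [Fintype V] [DecidableEq V] (S : Finset V)
    [DecidablePred fun e : Sym2 V => ∀ v ∈ e, v ∈ S] :
    ((offDiagPairs V).filter fun e => ∀ v ∈ e, v ∈ S) = S.offDiag.image Sym2.mk.uncurry := by
  ext e
  induction e with
  | _ x y =>
    simp only [offDiagPairs, Finset.mem_filter, Finset.mem_univ, true_and, Sym2.mk_isDiag_iff,
      Sym2.mem_iff, forall_eq_or_imp, forall_eq, Finset.mem_image, Finset.mem_offDiag,
      Prod.exists, Function.uncurry_apply_pair, Sym2.eq_iff]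
    constructor
    · rintro ⟨h1, h2, h3⟩
      exact ⟨x, y, ⟨h2, h3, h1⟩, Or.inl ⟨rfl, rfl⟩⟩
    · rintro ⟨a, b, ⟨h1, h2, h3⟩, ⟨rfl, rfl⟩ | ⟨rfl, rfl⟩⟩
      · exact ⟨h3, h1, h2⟩
      · exact ⟨Ne.symm h3, h2, h1⟩

lemma card_offDiagPairs (N : ℕ) : (offDiagPairs (Fin N)).card = N.choose 2 := by
  classical
  have h := filter_subset_eq_image (Finset.univ : Finset (Fin N))
  simp only [Finset.mem_univ, implies_true, Finset.filter_true] at h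
  rw [h, Sym2.card_image_offDiag, Finset.card_univ, Fintype.card_fin]

lemma sum_denseProb {N : ℕ} (p q : ℝ) (S : Finset (Fin N)) :
    ∑ e ∈ offDiagPairs (Fin N), denseProb p q S e =
      q * N.choose 2 + (p - q) * S.card.choose 2 := by
  classical
  have h : ∀ e, denseProb p q S e = q + if ∀ v ∈ e, v ∈ S then p - q else 0 := by
    intro e
    unfold denseProb
    split_ifs <;> ring
  simp_rw [h]
  rw [Finset.sum_add_distrib, Finset.sum_const, card_offDiagPairs, ← Finset.sum_filter,
    Finset.sum_const, filter_subset_eq_image, Sym2.card_image_offDiag]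
  simp only [nsmul_eq_mul]
  ring

lemma denseProb_mem {V : Type*} {p q : ℝ} (hp : p ∈ Set.Icc (0 : ℝ) 1) (hq : q ∈ Set.Icc (0 : ℝ) 1)
    (S : Finset V) (e : Sym2 V) : denseProb p q S e ∈ Set.Icc (0 : ℝ) 1 := by
  unfold denseProb
  split_ifs <;> assumption

/-- The edge count of a planted dense subgraph is concentrated. -/
lemma sum_bitsProb_denseProb_le {N : ℕ} {p q : ℝ} (hp : p ∈ Set.Icc (0 : ℝ) 1)
    (hq : q ∈ Set.Icc (0 : ℝ) 1) (S : Finset (Fin N)) {t : ℝ} (ht : 0 < t)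
    (F : SimpleGraph (Fin N) → ℝ) (hF : ∀ G, F G ≤ 1)
    (hF0 : ∀ G, |(G.edgeSet.ncard : ℝ) - (q * N.choose 2 + (p - q) * S.card.choose 2)| < t →
      F G ≤ 0) :
    ∑ f, bitsProb (denseProb p q S) f * F (bitGraph f) ≤ N ^ 2 / (8 * t ^ 2) := by
  classical
  calc _ ≤ ∑ f, bitsProb (denseProb p q S) f *
        (if t ≤ |∑ e ∈ offDiagPairs (Fin N), (bit (f e) - denseProb p q S e)| then 1 else 0) := by
        refine Finset.sum_le_sum fun f _ =>
          mul_le_mul_of_nonneg_left ?_ (bitsProb_nonneg (denseProb_mem hp hq S) f)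
        split_ifs with h
        · exact hF _
        · apply hF0
          rw [ncard_edgeSet_bitGraph, ← sum_denseProb, ← Finset.sum_sub_distrib]
          exact not_le.1 h
    _ ≤ (offDiagPairs (Fin N)).card / (4 * t ^ 2) :=
        sum_bitsProb_le_div (denseProb_mem hp hq S) _ ht
    _ ≤ _ := by
        rw [card_offDiagPairs, Nat.cast_choose_two, div_le_div_iff₀ (by positivity) (by positivity)]
        have : 0 ≤ t ^ 2 * N := by positivity
        nlinarith

/-- The threshold lies halfway between the two mean edge counts, so both errors are deviations by `Δ
/ 2`. The bound on `τ` keeps the program short. -/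
lemma errorPDS_countProg_le {N K : ℕ} {p q : I} (hK : 2 ≤ K) (hKN : K ≤ N) (hpq : q < p) :
    ∃ τ : ℕ, τ ≤ 2 * N ^ 2 ∧ errorPDS N K p q (countProg N τ) ≤
      ENNReal.ofReal (16 * N ^ 2 / (((p : ℝ) - q) ^ 2 * K ^ 4)) := by
  have hpq' : (0 : ℝ) < p - q := sub_pos.2 hpq
  have hK' : (2 : ℝ) ≤ K := by exact_mod_cast hK
  -- The gap between the mean edge counts; `2 ≤ K` makes `K.choose 2` at least `K ^ 2 / 4`.
  set Δ : ℝ := ((p : ℝ) - q) * K.choose 2 with hΔ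
  have hΔK : ((p : ℝ) - q) * (K ^ 2 / 4) ≤ Δ := by
    rw [hΔ, Nat.cast_choose_two]
    refine mul_le_mul_of_nonneg_left ?_ hpq'.le
    nlinarith
  have hΔ0 : 0 < Δ := lt_of_lt_of_le (by positivity) hΔK
  have hq0 : (0 : ℝ) ≤ q := q.2.1
  have hx : (0 : ℝ) ≤ q * N.choose 2 + Δ / 2 := by positivity
  have hbound : (N : ℝ) ^ 2 / (8 * (Δ / 2) ^ 2) ≤
      8 * N ^ 2 / (((p : ℝ) - q) ^ 2 * K ^ 4) := by
    rw [div_le_div_iff₀ (by positivity) (by positivity)]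
    have : (((p : ℝ) - q) * (K ^ 2 / 4)) ^ 2 ≤ Δ ^ 2 := by gcongr
    have hN : (0 : ℝ) ≤ N ^ 2 := by positivity
    nlinarith [mul_le_mul_of_nonneg_left this hN]
  refine ⟨⌊(q : ℝ) * N.choose 2 + Δ / 2⌋₊, ?_, ?_⟩
  · rw [← Nat.cast_le (α := ℝ)]
    refine (Nat.floor_le hx).trans ?_
    have h1 : (q : ℝ) * N.choose 2 ≤ 1 * N.choose 2 := by
      gcongr
      exact q.2.2
    have h2 : Δ ≤ 1 * K.choose 2 := by
      rw [hΔ]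
      gcongr
      linarith [p.2.2]
    have h3 : (K.choose 2 : ℝ) ≤ N.choose 2 := by exact_mod_cast Nat.choose_le_choose 2 hKN
    have h4 : (N.choose 2 : ℝ) ≤ N ^ 2 := by
      rw [Nat.cast_choose_two]
      have : (0 : ℝ) ≤ N := by positivity
      nlinarith
    push_cast
    linarith
  · rw [errorPDS, testError_eq]
    apply ENNReal.ofReal_le_ofReal
    have h0 : ∫ G, outputReal (countProg N ⌊(q : ℝ) * N.choose 2 + Δ / 2⌋₊) true G
        ∂(erdosRenyi N q) ≤ N ^ 2 / (8 * (Δ / 2) ^ 2) := by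
      rw [integral_erdosRenyi q id Function.injective_id.injOn]
      -- The null law is the degenerate dense law with `p = q`, so the same concentration bound
      -- applies.
      have := sum_bitsProb_denseProb_le (p := q) (q := q) q.2 q.2 (∅ : Finset (Fin N))
        (half_pos hΔ0) (outputReal (countProg N ⌊(q : ℝ) * N.choose 2 + Δ / 2⌋₊) true)
        (outputReal_le_one _ _) ?_
      · rwa [denseProb_self] at this
      · intro G hG
        rw [sub_self, zero_mul, add_zero, abs_lt] at hG
        rw [outputReal_countProg, if_neg]
        simp only [decide_eq_true_eq, not_lt]
        apply Nat.le_floor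
        linarith
    have h1 : ∫ G, outputReal (countProg N ⌊(q : ℝ) * N.choose 2 + Δ / 2⌋₊) false G
        ∂(plantedDense N K p q) ≤ N ^ 2 / (8 * (Δ / 2) ^ 2) := by
      rw [integral_plantedDense]
      have hc : (0 : ℝ) < N.choose K := by exact_mod_cast Nat.choose_pos hKN
      rw [inv_mul_le_iff₀ hc]
      refine (Finset.sum_le_card_nsmul _ _ (N ^ 2 / (8 * (Δ / 2) ^ 2)) fun S hS => ?_).trans ?_
      · rw [Finset.mem_powersetCard] at hS
        refine sum_bitsProb_denseProb_le p.2 q.2 S (half_pos hΔ0) _ (outputReal_le_one _ _) ?_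
        intro G hG
        rw [hS.2, ← hΔ, abs_lt] at hG
        rw [outputReal_countProg, if_neg]
        simp only [decide_eq_false_iff_not, not_not]
        rw [Nat.floor_lt hx]
        linarith
      · simp
    calc _ ≤ _ := add_le_add (h0.trans hbound) (h1.trans hbound)
      _ = _ := by ring

/-- Above the boundary the edge count solves the detection problem. -/
theorem exists_isPolyTime_of_lt {α β : ℝ} (hβ : 0 < β) (h : 1 / 2 + α / 2 < β) {N K : ℕ → ℕ}
    {p q : ℕ → I} (hR : DenseRegime α β N K p q) :
    ∃ A : ℕ → Prog, IsPolyTime N A ∧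
      limsup (fun n => errorPDS (N n) (K n) (p n) (q n) (A n)) atTop = 0 := by
  have key : ∀ n, ∃ τ : ℕ, τ ≤ 2 * N n ^ 2 ∧ (2 ≤ K n →
      errorPDS (N n) (K n) (p n) (q n) (countProg (N n) τ) ≤
        ENNReal.ofReal (16 * N n ^ 2 / (((p n : ℝ) - q n) ^ 2 * K n ^ 4))) := by
    intro n
    by_cases hK : 2 ≤ K n
    · obtain ⟨τ, h1, h2⟩ := errorPDS_countProg_le hK (hR.K_le n) (hR.q_lt_p n)
      exact ⟨τ, h1, fun _ => h2⟩
    -- An arbitrary threshold: `K n < 2` occurs only finitely often, which the limsup ignores.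
    · exact ⟨0, Nat.zero_le _, fun h => absurd h hK⟩
  choose τ hτ herr using key
  have hL : Tendsto (fun n => Real.log (N n)) atTop atTop :=
    Real.tendsto_log_atTop.comp (tendsto_natCast_atTop_atTop.comp hR.tendsto_N)
  have hK : ∀ᶠ n in atTop, 2 ≤ K n := by
    filter_upwards [hR.sparsity.eventually (lt_mem_nhds hβ), hL.eventually_gt_atTop 0] with n h1 h2
    have h3 : 0 < Real.log (K n) := by
      by_contra h3
      exact absurd h1 (not_lt.2 (div_nonpos_of_nonpos_of_nonneg (not_lt.1 h3) h2.le))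
    by_contra h4
    have : K n = 0 ∨ K n = 1 := by omega
    rcases this with h5 | h5 <;> simp [h5] at h3
  refine ⟨fun n => countProg (N n) (τ n), ?_, ?_⟩
  · refine ⟨(Polynomial.X * Polynomial.X + 1) *
      (2 * Polynomial.X + 4 * Polynomial.X ^ 2 + 21) + 1, fun n => ?_⟩
    have he : ((Polynomial.X * Polynomial.X + 1) *
      (2 * Polynomial.X + 4 * Polynomial.X ^ 2 + 21) + 1 : Polynomial ℕ).eval (N n) =
        (N n * N n + 1) * (2 * N n + 4 * N n ^ 2 + 21) + 1 := by simp
    rw [he]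
    refine ⟨(length_countProg _ _).trans ?_, fun G => (haltsWithin_countProg _ G).mono ?_⟩
    · have := hτ n
      refine Nat.add_le_add_right (Nat.mul_le_mul_left _ ?_) 1
      omega
    · nlinarith [sq_nonneg (N n)]
  -- This is the logarithm of the error bound; the factor of `log N` tends to 2 + 2α - 4β < 0.
  · have hE : Tendsto (fun n => Real.log 16 + Real.log (N n) *
        (2 + 2 * (Real.log ((p n : ℝ) - q n)⁻¹ / Real.log (N n)) -
          4 * (Real.log (K n) / Real.log (N n)))) atTop atBot := by
      refine tendsto_atBot_add_const_left _ _ ?_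
      have h2 : Tendsto (fun n => 2 + 2 * (Real.log ((p n : ℝ) - q n)⁻¹ / Real.log (N n)) -
          4 * (Real.log (K n) / Real.log (N n))) atTop (𝓝 (2 + 2 * α - 4 * β)) :=
        (tendsto_const_nhds.add (hR.signal.const_mul 2)).sub (hR.sparsity.const_mul 4)
      exact hL.atTop_mul_neg (by linarith) h2
    have hB : Tendsto (fun n => 16 * (N n : ℝ) ^ 2 / (((p n : ℝ) - q n) ^ 2 * (K n : ℝ) ^ 4))
        atTop (𝓝 0) := by
      refine (Real.tendsto_exp_atBot.comp hE).congr' ?_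
      filter_upwards [hK, hL.eventually_gt_atTop 0] with n h1 h2
      have hK0 : (0 : ℝ) < K n := by exact_mod_cast (by omega : 0 < K n)
      have hN0 : (0 : ℝ) < N n := hK0.trans_le (by exact_mod_cast hR.K_le n)
      have hpq : (0 : ℝ) < p n - q n := sub_pos.2 (hR.q_lt_p n)
      have h3 : Real.log 16 + Real.log (N n) *
        (2 + 2 * (Real.log ((p n : ℝ) - q n)⁻¹ / Real.log (N n)) -
          4 * (Real.log (K n) / Real.log (N n))) =
          Real.log (16 * (N n : ℝ) ^ 2 / (((p n : ℝ) - q n) ^ 2 * (K n : ℝ) ^ 4)) := by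
        rw [Real.log_div (by positivity) (by positivity), Real.log_mul (by positivity)
          (by positivity), Real.log_mul (by positivity) (by positivity), Real.log_pow,
          Real.log_pow, Real.log_pow, Real.log_inv]
        field_simp
        push_cast
        ring
      rw [Function.comp, h3, Real.exp_log (by positivity)]
    have hB' : Tendsto (fun n => ENNReal.ofReal
        (16 * (N n : ℝ) ^ 2 / (((p n : ℝ) - q n) ^ 2 * (K n : ℝ) ^ 4))) atTop (𝓝 0) := by
      simpa using ENNReal.tendsto_ofReal hB
    refine (tendsto_of_tendsto_of_tendsto_of_le_of_le' tendsto_const_nhds hB'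
      (Eventually.of_forall fun _ => bot_le) ?_).limsup_eq
    filter_upwards [hK] with n hn
    exact herr n hn

/-! ## Replacing a random bit by a block of random bits -/

/-- The truncation `min P (2U)` has mass s ≤ 1 and leaves room of mass 2 - s below `2U`. Filling the
fraction (1 - s) / (2 - s) of that room restores total mass 1. -/
lemma exists_kernel {B : Type*} [Fintype B] {U P : B → ℝ} (hU : ∑ g, U g = 1) (hP : ∑ g, P g = 1) :
    ∃ Q : B → ℝ, (∀ g, min (P g) (2 * U g) ≤ Q g) ∧ (∀ g, Q g ≤ 2 * U g) ∧ ∑ g, Q g = 1 := by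
  set s := ∑ g, min (P g) (2 * U g) with hs
  have hs1 : s ≤ 1 := by
    rw [← hP]
    exact Finset.sum_le_sum fun g _ => min_le_left _ _
  have ht0 : 0 ≤ (1 - s) / (2 - s) := div_nonneg (by linarith) (by linarith)
  have ht1 : (1 - s) / (2 - s) ≤ 1 := by
    rw [div_le_one (by linarith)]
    linarith
  refine ⟨fun g => min (P g) (2 * U g) + (1 - s) / (2 - s) * (2 * U g - min (P g) (2 * U g)),
    fun g => ?_, fun g => ?_, ?_⟩
  · have := min_le_right (P g) (2 * U g)
    nlinarith
  · have := min_le_right (P g) (2 * U g)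
    nlinarith
  · rw [Finset.sum_add_distrib, ← Finset.mul_sum, Finset.sum_sub_distrib, ← Finset.mul_sum, hU,
      ← hs]
    have : 2 - s ≠ 0 := by linarith
    field_simp
    ring

lemma bern_add (δ : ℝ) (b : Bool) :
    bern (1 / 2 + δ) b = bern (1 / 2) b * (1 + (if b then 2 * δ else - (2 * δ))) := by
  cases b <;> simp [bern] <;> ring

/-- Slightly biased bits are dominated by twice the uniform bits, up to a small error. -/
lemma one_sub_le_sum_min {B : Type*} [Fintype B] [DecidableEq B] {δ : ℝ} {j : ℕ} (hδ0 : 0 ≤ δ)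
    (hδ1 : 2 * δ ≤ 1) (hj : j ≠ 0) (hB : (2 * j * δ) ^ 2 * Fintype.card B ≤ 1) :
    1 - 4 / 2 ^ j ≤ ∑ g : B → Bool, min (bitsProb (fun _ => 1 / 2 + δ) g)
      (2 * bitsProb (fun _ => 1 / 2) g) := by
  set ℓ : Bool → ℝ := fun b => 1 + (if b then 2 * δ else - (2 * δ)) with hℓ
  have hℓ0 : ∀ b, 0 ≤ ℓ b := by
    intro b
    cases b <;> simp [hℓ] <;> linarith
  have hPU : ∀ g : B → Bool, bitsProb (fun _ => 1 / 2 + δ) g =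
      bitsProb (fun _ => 1 / 2) g * ∏ e, ℓ (g e) := by
    intro g
    unfold bitsProb
    rw [← Finset.prod_mul_distrib]
    exact Finset.prod_congr rfl fun e _ => bern_add _ _
  have hU0 : ∀ g : B → Bool, 0 ≤ bitsProb (fun _ => (1 / 2 : ℝ)) g :=
    fun g => bitsProb_nonneg (fun _ => by norm_num) g
  -- With l the likelihood ratio, mass is lost only where l > 2, and there u l ≤ 2 u (l / 2)^j. The
  -- loss is thus bounded by a j-th moment, which factorises over the bits.
  have h1 : ∀ g : B → Bool, bitsProb (fun _ => 1 / 2 + δ) g -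
      2 / 2 ^ j * (bitsProb (fun _ => 1 / 2) g * ∏ e, ℓ (g e) ^ j) ≤
      min (bitsProb (fun _ => 1 / 2 + δ) g) (2 * bitsProb (fun _ => 1 / 2) g) := by
    intro g
    rw [Finset.prod_pow, hPU]
    set u := bitsProb (fun _ => (1 / 2 : ℝ)) g
    set l := ∏ e, ℓ (g e)
    have hu : 0 ≤ u := hU0 g
    have hl : 0 ≤ l := Finset.prod_nonneg fun e _ => hℓ0 _
    rw [le_min_iff]
    have h3 : 0 ≤ 2 / 2 ^ j * (u * l ^ j) := by positivity
    refine ⟨by linarith, ?_⟩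
    have h5 : 2 / 2 ^ j * (u * l ^ j) = 2 * u * (l / 2) ^ j := by
      rw [div_pow]; ring
    rcases le_total l 2 with h4 | h4
    · nlinarith
    · have h6 : l / 2 ≤ (l / 2) ^ j := le_self_pow₀ (by linarith) hj
      rw [h5]
      nlinarith [mul_le_mul_of_nonneg_left h6 hu]
  refine le_trans ?_ (Finset.sum_le_sum fun g _ => h1 g)
  rw [Finset.sum_sub_distrib, sum_bitsProb, ← Finset.mul_sum,
    sum_bitsProb_mul_prod (fun _ : B => (1 / 2 : ℝ)) fun _ b => ℓ b ^ j]
  -- The two signs average to cosh(2jδ) ≤ exp((2jδ)² / 2). The hypothesis on the block size turns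
  -- the product over all bits into at most e^(1/2) ≤ 2.
  have h2 : ∑ b, bern (1 / 2) b * ℓ b ^ j ≤ Real.exp ((2 * j * δ) ^ 2 / 2) := by
    refine le_trans ?_ (Real.cosh_le_exp_half_sq _)
    have e1 : (1 + 2 * δ) ^ j ≤ Real.exp (2 * j * δ) := by
      rw [show 2 * (j : ℝ) * δ = j * (2 * δ) by ring, Real.exp_nat_mul]
      exact pow_le_pow_left₀ (by linarith) (by linarith [Real.add_one_le_exp (2 * δ)]) j
    have e2 : (1 + - (2 * δ)) ^ j ≤ Real.exp (-(2 * j * δ)) := by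
      rw [show -(2 * (j : ℝ) * δ) = j * (-(2 * δ)) by ring, Real.exp_nat_mul]
      exact pow_le_pow_left₀ (by linarith) (by linarith [Real.add_one_le_exp (-(2 * δ))]) j
    rw [Real.cosh_eq, Fintype.sum_bool, bern_half, bern_half]
    simp only [hℓ, if_true, Bool.false_eq_true, if_false]
    linarith
  have h3 : ∏ _e : B, ∑ b, bern (1 / 2) b * ℓ b ^ j ≤ 2 := by
    rw [Finset.prod_const, Finset.card_univ]
    calc _ ≤ Real.exp ((2 * j * δ) ^ 2 / 2) ^ Fintype.card B :=
          pow_le_pow_left₀ (Finset.sum_nonneg fun b _ => mul_nonneg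
            (bern_nonneg (by norm_num) (by norm_num) b) (pow_nonneg (hℓ0 b) j)) h2 _
      _ = Real.exp (Fintype.card B * ((2 * j * δ) ^ 2 / 2)) := (Real.exp_nat_mul _ _).symm
      _ ≤ Real.exp (1 / 2) := by
          apply Real.exp_le_exp.2
          linarith
      _ ≤ 2 := by
          have := Real.exp_bound_div_one_sub_of_interval (x := 1 / 2) (by norm_num) (by norm_num)
          norm_num at this ⊢
          exact this
  have h4 : (0 : ℝ) ≤ 2 / 2 ^ j := by positivity
  have h5 := mul_le_mul_of_nonneg_left h3 h4
  have h6 : (2 : ℝ) / 2 ^ j * 2 = 4 / 2 ^ j := by ring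
  linarith

section Lift

variable {E Z : Type*} [Fintype E] [DecidableEq E] [Fintype Z] [DecidableEq Z]

/-- A family of random blocks: `κ z b` is the law of the bits in the block `z` if the bit of the
block is `b`. A uniform bit gives uniform bits in the block; the bit `1` gives bits with mean `p`,
up to an error `η`. -/
structure LiftKernel (blk : E → Z) (p η : ℝ) where
  κ : ∀ z, Bool → ({e // blk e = z} → Bool) → ℝ
  nonneg : ∀ z b g, 0 ≤ κ z b g
  sum_eq_one : ∀ z b, ∑ g, κ z b g = 1
  add_eq : ∀ z g, κ z true g + κ z false g = 2 * bitsProb (fun _ => 1 / 2) g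
  min_le : ∀ z g, min (bitsProb (fun _ => p) g) (2 * bitsProb (fun _ => 1 / 2) g) ≤ κ z true g
  le_sum_min : ∀ z, 1 - η ≤ ∑ g : {e // blk e = z} → Bool,
    min (bitsProb (fun _ => p) g) (2 * bitsProb (fun _ => 1 / 2) g)

/-- The bit 1 gets the law Q of `exists_kernel` and the bit 0 gets 2U - Q, which is nonnegative
because Q ≤ 2U; their average is exactly uniform. -/
lemma nonempty_liftKernel {E Z : Type*} [Fintype E] [DecidableEq E] [DecidableEq Z] (blk : E → Z) {δ : ℝ} {j : ℕ} (hδ0 : 0 ≤ δ)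
    (hδ1 : 2 * δ ≤ 1) (hj : j ≠ 0)
    (hB : ∀ z, (2 * j * δ) ^ 2 * Fintype.card {e // blk e = z} ≤ 1) :
    Nonempty (LiftKernel blk (1 / 2 + δ) (4 / 2 ^ j)) := by
  have hU0 : ∀ z (g : {e // blk e = z} → Bool), 0 ≤ bitsProb (fun _ => (1 / 2 : ℝ)) g :=
    fun z g => bitsProb_nonneg (fun _ => by norm_num) g
  have hP0 : ∀ z (g : {e // blk e = z} → Bool), 0 ≤ bitsProb (fun _ => (1 / 2 + δ : ℝ)) g :=
    fun z g => bitsProb_nonneg (fun _ => ⟨by linarith, by linarith⟩) g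
  choose Q hQ1 hQ2 hQ3 using fun z => exists_kernel
    (U := fun g : {e // blk e = z} → Bool => bitsProb (fun _ => (1 / 2 : ℝ)) g)
    (P := fun g => bitsProb (fun _ => (1 / 2 + δ : ℝ)) g) (sum_bitsProb _) (sum_bitsProb _)
  refine ⟨⟨fun z b g => if b then Q z g else 2 * bitsProb (fun _ => 1 / 2) g - Q z g,
    fun z b g => ?_, fun z b => ?_, fun z g => ?_, fun z g => ?_, fun z => ?_⟩⟩
  · cases b
    · simpa using hQ2 z g
    · simpa using le_trans (le_min (hP0 z g) (mul_nonneg zero_le_two (hU0 z g))) (hQ1 z g)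
  · cases b
    · simp only [Bool.false_eq_true, if_false]
      rw [Finset.sum_sub_distrib, ← Finset.mul_sum, sum_bitsProb, hQ3]
      norm_num
    · simpa using hQ3 z
  · simp
  · simpa using hQ1 z g
  · exact one_sub_le_sum_min hδ0 hδ1 hj (hB z)

namespace LiftKernel

variable {blk : E → Z} {p η : ℝ} (κ : LiftKernel blk p η)

/-- The law of all bits, given the bits `b` of the blocks. -/
def law (b : Z → Bool) (h : E → Bool) : ℝ := ∏ z, κ.κ z (b z) fun e => h e

lemma law_nonneg (b : Z → Bool) (h : E → Bool) : 0 ≤ κ.law b h :=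
  Finset.prod_nonneg fun z _ => κ.nonneg z _ _

lemma sum_law (b : Z → Bool) : ∑ h, κ.law b h = 1 := by
  unfold law
  rw [sum_prod_fibers blk fun z => κ.κ z (b z)]
  simp [κ.sum_eq_one]

/-- The bits can be chosen from two families that are drawn before `b` is known. -/
lemma sum_law_eq (b : Z → Bool) (Ψ : (E → Bool) → ℝ) :
    ∑ c₁, ∑ c₀, κ.law (fun _ => true) c₁ * κ.law (fun _ => false) c₀ *
      Ψ (fun e => if b (blk e) then c₁ e else c₀ e) = ∑ h, κ.law b h * Ψ h := by
  have key := sum_sum_mix (Z := Z) (X := fun z => {e // blk e = z} → Bool) (fun z => b z = true)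
    (κ := fun z => κ.κ z true) (κ' := fun z => κ.κ z false) (fun z => κ.sum_eq_one z true)
    (fun z => κ.sum_eq_one z false) (fun x => Ψ ((fiberEquiv blk Bool).symm x))
  refine Eq.trans ?_ (key.trans (Eq.symm ?_))
  · refine Fintype.sum_equiv (fiberEquiv blk Bool) _ _ fun c₁ =>
      Fintype.sum_equiv (fiberEquiv blk Bool) _ _ fun c₀ => ?_
    have h : ((fiberEquiv blk Bool).symm fun z =>
        if b z = true then fiberEquiv blk Bool c₁ z else fiberEquiv blk Bool c₀ z) =
        fun e => if b (blk e) then c₁ e else c₀ e := by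
      funext e
      by_cases he : b (blk e) = true <;> simp [fiberEquiv, he]
    rw [h]
    rfl
  · apply Fintype.sum_equiv (fiberEquiv blk Bool)
    intro h
    rw [Equiv.symm_apply_apply]
    congr 1
    refine Finset.prod_congr rfl fun z _ => ?_
    cases b z <;> simp [fiberEquiv]

-- A uniform block bit averages the two kernels into the uniform law, so only blocks in `Z₁` keep
-- the kernel of the bit 1.
open Classical in
lemma sum_bitsProb_law (Z₁ : Finset Z) (Ψ : (E → Bool) → ℝ) :
    ∑ b, bitsProb (fun z => if z ∈ Z₁ then 1 else 1 / 2) b * ∑ h, κ.law b h * Ψ h =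
      ∑ h, (∏ z, if z ∈ Z₁ then κ.κ z true (fun e => h e) else
        bitsProb (fun _ => 1 / 2) (fun e : {e // blk e = z} => h e)) * Ψ h := by
  simp_rw [Finset.mul_sum]
  rw [Finset.sum_comm]
  refine Finset.sum_congr rfl fun h _ => ?_
  simp_rw [← mul_assoc]
  rw [← Finset.sum_mul]
  congr 1
  unfold law
  rw [sum_bitsProb_mul_prod _ fun z b => κ.κ z b fun e => h e]
  refine Finset.prod_congr rfl fun z _ => ?_
  by_cases hz : z ∈ Z₁
  · simp [hz, bern]
  · have := κ.add_eq z fun e => h e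
    simp only [hz, if_false, bern_half, Fintype.sum_bool]
    linarith

lemma sum_bitsProb_law_empty (Ψ : (E → Bool) → ℝ) :
    ∑ b, bitsProb (fun _ => 1 / 2) b * ∑ h, κ.law b h * Ψ h =
      ∑ h, bitsProb (fun _ => 1 / 2) h * Ψ h := by
  have := κ.sum_bitsProb_law ∅ Ψ
  simp only [Finset.notMem_empty, if_false] at this
  rw [this]
  refine Finset.sum_congr rfl fun h _ => ?_
  congr 1
  unfold bitsProb
  exact Fintype.prod_fiberwise blk fun e => bern (1 / 2) (h e)

-- The blockwise truncations multiply to a sub-probability `ν` lying below both the produced law and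
-- the target law. By the union bound its missing mass is at most `Z₁.card * η`, and this controls
-- the difference for every test with values in [0, 1].
open Classical in
lemma sum_bitsProb_law_le (hp : p ∈ Set.Icc (0 : ℝ) 1) (hη0 : 0 ≤ η) (hη1 : η ≤ 1) (Z₁ : Finset Z)
    {Ψ : (E → Bool) → ℝ}
    (h0 : ∀ h, 0 ≤ Ψ h) (h1 : ∀ h, Ψ h ≤ 1) :
    ∑ b, bitsProb (fun z => if z ∈ Z₁ then 1 else 1 / 2) b * ∑ h, κ.law b h * Ψ h ≤
      ∑ h, bitsProb (fun e => if blk e ∈ Z₁ then p else 1 / 2) h * Ψ h + Z₁.card * η := by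
  rw [sum_bitsProb_law]
  have hU0 : ∀ z (g : {e // blk e = z} → Bool), 0 ≤ bitsProb (fun _ => (1 / 2 : ℝ)) g :=
    fun z g => bitsProb_nonneg (fun _ => by norm_num) g
  have hP0 : ∀ z (g : {e // blk e = z} → Bool), 0 ≤ bitsProb (fun _ => p) g :=
    fun z g => bitsProb_nonneg (fun _ => hp) g
  set C : ∀ z, ({e // blk e = z} → Bool) → ℝ := fun z g => if z ∈ Z₁ then
    min (bitsProb (fun _ => p) g) (2 * bitsProb (fun _ => 1 / 2) g) else
      bitsProb (fun _ => 1 / 2) g with hC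
  set A : (E → Bool) → ℝ := fun h => ∏ z, if z ∈ Z₁ then κ.κ z true (fun e => h e) else
        bitsProb (fun _ => 1 / 2) (fun e : {e // blk e = z} => h e) with hA
  set ν : (E → Bool) → ℝ := fun h => ∏ z, C z fun e => h e with hν
  have hC0 : ∀ z g, 0 ≤ C z g := by
    intro z g
    simp only [hC]
    split_ifs
    · exact le_min (hP0 z g) (mul_nonneg zero_le_two (hU0 z g))
    · exact hU0 z g
  have hνA : ∀ h, ν h ≤ A h := fun h => Finset.prod_le_prod (fun z _ => hC0 z _) fun z _ => by
    simp only [hC]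
    split_ifs
    · exact κ.min_le z _
    · exact le_rfl
  have hνB : ∀ h, ν h ≤ bitsProb (fun e => if blk e ∈ Z₁ then p else 1 / 2) h := by
    intro h
    have : bitsProb (fun e => if blk e ∈ Z₁ then p else 1 / 2) h =
        ∏ z, ∏ e : {e // blk e = z}, bern (if z ∈ Z₁ then p else 1 / 2) (h e) := by
      unfold bitsProb
      rw [← Fintype.prod_fiberwise blk]
      refine Finset.prod_congr rfl fun z _ => Finset.prod_congr rfl fun e _ => ?_
      simp only [e.2]
    rw [this]
    refine Finset.prod_le_prod (fun z _ => hC0 z _) fun z _ => ?_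
    simp only [hC]
    split_ifs
    · exact min_le_left _ _
    · exact le_rfl
  have hA1 : ∑ h, A h = 1 := by
    rw [hA, sum_prod_fibers blk fun z g => if z ∈ Z₁ then κ.κ z true g else
        bitsProb (fun _ => 1 / 2) g]
    apply Finset.prod_eq_one
    intro z _
    by_cases hz : z ∈ Z₁
    · simp [hz, κ.sum_eq_one]
    · simp only [hz, if_false, sum_bitsProb]
  have hν1 : 1 - Z₁.card * η ≤ ∑ h, ν h := by
    rw [hν, sum_prod_fibers blk C]
    have e1 : ∏ z, (if z ∈ Z₁ then (1 - η) else 1) ≤ ∏ z, ∑ g, C z g := by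
      refine Finset.prod_le_prod (fun z _ => ?_) fun z _ => ?_
      · split_ifs <;> linarith
      · simp only [hC]
        split_ifs
        · exact κ.le_sum_min z
        · rw [sum_bitsProb]
    refine le_trans ?_ e1
    rw [Fintype.prod_ite_mem]
    have := one_sub_sum_le_prod Z₁ (fun _ => η) (fun _ => hη0) (fun _ => hη1)
    simpa using this
  have e2 : ∑ h, A h * Ψ h - ∑ h, ν h * Ψ h ≤ 1 - ∑ h, ν h := by
    rw [← hA1, ← Finset.sum_sub_distrib, ← Finset.sum_sub_distrib]
    refine Finset.sum_le_sum fun h _ => ?_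
    nlinarith [hνA h, h1 h, h0 h]
  have e3 : ∑ h, ν h * Ψ h ≤ ∑ h, bitsProb (fun e => if blk e ∈ Z₁ then p else 1 / 2) h * Ψ h :=
    Finset.sum_le_sum fun h _ => mul_le_mul_of_nonneg_right (hνB h) (h0 h)
  linarith

end LiftKernel

end Lift

/-! ## Random subsets -/

lemma card_filter_powersetCard {V : Type*} [DecidableEq V] {D T : Finset V} {n : ℕ}
    (hT : T ⊆ D) (hn : T.card ≤ n) :
    ((D.powersetCard n).filter (T ⊆ ·)).card = (D.card - T.card).choose (n - T.card) := by
  rw [← Finset.card_sdiff_of_subset hT, ← Finset.card_powersetCard]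
  refine Finset.card_nbij' (· \ T) (· ∪ T) ?_ ?_ ?_ ?_
  · intro E hE
    simp only [Finset.coe_filter, Finset.mem_powersetCard, Set.mem_ofPred_eq] at hE
    simp only [Finset.mem_coe, Finset.mem_powersetCard]
    exact ⟨Finset.sdiff_subset_sdiff hE.1.1 le_rfl, by rw [Finset.card_sdiff_of_subset hE.2, hE.1.2]⟩
  · intro E hE
    simp only [Finset.mem_coe, Finset.mem_powersetCard] at hE
    simp only [Finset.coe_filter, Finset.mem_powersetCard, Set.mem_ofPred_eq]
    have hd : Disjoint E T := Finset.disjoint_of_subset_left hE.1 Finset.sdiff_disjoint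
    refine ⟨⟨Finset.union_subset (hE.1.trans Finset.sdiff_subset) hT, ?_⟩,
      Finset.subset_union_right⟩
    rw [Finset.card_union_of_disjoint hd, hE.2]
    omega
  · intro E hE
    simp only [Finset.coe_filter, Finset.mem_powersetCard, Set.mem_ofPred_eq] at hE
    exact Finset.sdiff_union_of_subset hE.2
  · intro E hE
    simp only [Finset.mem_coe, Finset.mem_powersetCard] at hE
    have hd : Disjoint E T := Finset.disjoint_of_subset_left hE.1 Finset.sdiff_disjoint
    simp only [Finset.union_sdiff_right]
    exact Finset.sdiff_eq_self_of_disjoint hd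

/-- A random subset of a random subset is a random subset. -/
lemma sum_powersetCard_powersetCard {V : Type*} [DecidableEq V] (D : Finset V) {n k : ℕ}
    (hkn : k ≤ n) (hn : n ≤ D.card) (F : Finset V → ℝ) :
    (D.card.choose n : ℝ)⁻¹ * ∑ E ∈ D.powersetCard n, (n.choose k : ℝ)⁻¹ *
      ∑ T ∈ E.powersetCard k, F T = (D.card.choose k : ℝ)⁻¹ * ∑ T ∈ D.powersetCard k, F T := by
  have h1 : ∑ E ∈ D.powersetCard n, ∑ T ∈ E.powersetCard k, F T =
      ∑ T ∈ D.powersetCard k, ∑ E ∈ (D.powersetCard n).filter (T ⊆ ·), F T := by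
    refine Finset.sum_comm' fun E T => ?_
    simp only [Finset.mem_powersetCard, Finset.mem_filter]
    constructor
    · rintro ⟨⟨h1, h2⟩, h3, h4⟩
      exact ⟨⟨⟨h1, h2⟩, h3⟩, h3.trans h1, h4⟩
    · rintro ⟨⟨⟨h1, h2⟩, h3⟩, h4, h5⟩
      exact ⟨⟨h1, h2⟩, h3, h5⟩
  have h2 : ∑ T ∈ D.powersetCard k, ∑ E ∈ (D.powersetCard n).filter (T ⊆ ·), F T =
      ((D.card - k).choose (n - k) : ℝ) * ∑ T ∈ D.powersetCard k, F T := by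
    rw [Finset.mul_sum]
    refine Finset.sum_congr rfl fun T hT => ?_
    rw [Finset.mem_powersetCard] at hT
    rw [Finset.sum_const, card_filter_powersetCard hT.1 (hT.2.trans_le hkn), hT.2, nsmul_eq_mul]
  rw [← Finset.mul_sum, h1, h2]
  have h3 : (D.card.choose n : ℝ) * n.choose k = D.card.choose k * (D.card - k).choose (n - k) := by
    exact_mod_cast Nat.choose_mul (n := D.card) (k := n) (s := k) hkn
  have e1 : (D.card.choose n : ℝ) ≠ 0 := by exact_mod_cast (Nat.choose_pos hn).ne'
  have e2 : (n.choose k : ℝ) ≠ 0 := by exact_mod_cast (Nat.choose_pos hkn).ne'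
  have e3 : (D.card.choose k : ℝ) ≠ 0 := by exact_mod_cast (Nat.choose_pos (hkn.trans hn)).ne'
  field_simp
  rw [h3]
  ring

/-- A random permutation of a set is a random set. -/
lemma sum_perm_map {V : Type*} [Fintype V] [DecidableEq V] {K : ℕ} {B : Finset V} (hB : B.card = K)
    (F : Finset V → ℝ) :
    ((Fintype.card V).factorial : ℝ)⁻¹ * ∑ g : Equiv.Perm V, F (B.map g.toEmbedding) =
      ((Fintype.card V).choose K : ℝ)⁻¹ * ∑ T ∈ Finset.univ.powersetCard K, F T := by
  -- The sum over permutations is the same for all sets of size `K`, as some permutation carries one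
  -- to another; summing over all such sets and exchanging the sums gives the claim.
  have h1 : ∀ T ∈ (Finset.univ : Finset V).powersetCard K,
      ∑ g : Equiv.Perm V, F (T.map g.toEmbedding) =
        ∑ g : Equiv.Perm V, F (B.map g.toEmbedding) := by
    intro T hT
    rw [Finset.mem_powersetCard] at hT
    obtain ⟨τ, hτ⟩ : ∃ τ : Equiv.Perm V, T.map τ.toEmbedding = B := by
      have e : {x // x ∈ T} ≃ {x // x ∈ B} := Fintype.equivOfCardEq (by simp [hT.2, hB])
      refine ⟨e.extendSubtype, ?_⟩
      apply Finset.eq_of_subset_of_card_le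
      · intro y hy
        rw [Finset.mem_map] at hy
        obtain ⟨x, hx, rfl⟩ := hy
        exact e.extendSubtype_mem x hx
      · rw [Finset.card_map, hT.2, hB]
    rw [← Fintype.sum_equiv (Equiv.mulRight τ) (fun g => F (T.map (g * τ).toEmbedding)) _
      fun g => rfl]
    refine Finset.sum_congr rfl fun g _ => ?_
    rw [← hτ, Finset.map_map]
    rfl
  have h2 : ∀ g : Equiv.Perm V, ∑ T ∈ (Finset.univ : Finset V).powersetCard K,
      F (T.map g.toEmbedding) = ∑ T ∈ (Finset.univ : Finset V).powersetCard K, F T := by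
    intro g
    have := Finset.powersetCard_map g.toEmbedding K Finset.univ
    rw [Finset.univ_map_equiv_to_embedding] at this
    conv_rhs => rw [this, Finset.sum_map]
    rfl
  have h3 := Finset.sum_congr rfl h1
  rw [Finset.sum_comm, Finset.sum_congr rfl fun g _ => h2 g, Finset.sum_const, Finset.sum_const,
    Finset.card_powersetCard, Finset.card_univ, Finset.card_univ, Fintype.card_perm, nsmul_eq_mul,
    nsmul_eq_mul] at h3
  have hKV : K ≤ Fintype.card V := hB ▸ Finset.card_le_univ B
  have e1 : ((Fintype.card V).choose K : ℝ) ≠ 0 := by exact_mod_cast (Nat.choose_pos hKV).ne'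
  have e2 : ((Fintype.card V).factorial : ℝ) ≠ 0 := by exact_mod_cast Nat.factorial_ne_zero _
  field_simp
  linarith

/-- About half of all vertices contain about `2 ^ (-k)` of all sets of `k` vertices. -/
lemma one_sub_mul_choose_le {M d k : ℕ} {t : ℝ} (ht : 0 ≤ t) (hM : 0 < M)
    (hd : (M : ℝ) / 2 - t ≤ d) :
    (1 - 2 * k * (t + k) / M) * M.choose k ≤ 2 ^ k * d.choose k := by
  have hM' : (0 : ℝ) < M := by exact_mod_cast hM
  by_cases h0 : 1 - 2 * (k : ℝ) * (t + k) / M ≤ 0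
  · exact (mul_nonpos_of_nonpos_of_nonneg h0 (by positivity)).trans (by positivity)
  rcases Nat.eq_zero_or_pos k with rfl | hk
  · simp
  have hk1 : (1 : ℝ) ≤ k := by exact_mod_cast hk
  have h0' : 2 * (k : ℝ) * (t + k) < M := by
    rw [not_le, sub_pos, div_lt_one hM'] at h0
    exact h0
  have h1 : t + k ≤ k * (t + k) := by nlinarith
  have hkd : k ≤ d := by
    rw [← Nat.cast_le (α := ℝ)]
    linarith
  have hf : (0 : ℝ) < k.factorial := by exact_mod_cast Nat.factorial_pos k
  rw [← mul_le_mul_iff_of_pos_right hf]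
  have c1 : (M.choose k : ℝ) * k.factorial ≤ (M : ℝ) ^ k := by
    have h := Nat.descFactorial_le_pow M k
    rw [Nat.descFactorial_eq_factorial_mul_choose, mul_comm] at h
    exact_mod_cast h
  have c2 : ((M : ℝ) / 2 - t - k) ^ k ≤ (d.choose k : ℝ) * k.factorial := by
    have h := Nat.pow_sub_le_descFactorial d k
    rw [Nat.descFactorial_eq_factorial_mul_choose, mul_comm] at h
    have h' : ((d + 1 - k : ℕ) : ℝ) ^ k ≤ (d.choose k : ℝ) * k.factorial := by exact_mod_cast h
    refine le_trans (pow_le_pow_left₀ (by linarith) ?_ k) h'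
    rw [Nat.cast_sub (by omega)]
    push_cast
    linarith
  -- Bernoulli's inequality for the ratio of 2^k (M/2 - t - k)^k to M^k, which bound the two falling
  -- factorials.
  have c3 : 1 - 2 * (k : ℝ) * (t + k) / M ≤ (1 + - (2 * (t + k) / M)) ^ k := by
    refine le_trans (le_of_eq ?_) (one_add_mul_le_pow ?_ k)
    · ring
    · rw [neg_le_neg_iff, div_le_iff₀ hM']
      linarith
  calc (1 - 2 * (k : ℝ) * (t + k) / M) * M.choose k * k.factorial
      ≤ (1 - 2 * (k : ℝ) * (t + k) / M) * M ^ k := by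
        rw [mul_assoc]
        exact mul_le_mul_of_nonneg_left c1 (not_le.1 h0).le
    _ ≤ (1 + - (2 * (t + k) / M)) ^ k * M ^ k := by gcongr
    _ = 2 ^ k * ((M : ℝ) / 2 - t - k) ^ k := by
        rw [← mul_pow, ← mul_pow]
        congr 1
        field_simp
        ring
    _ ≤ 2 ^ k * (d.choose k * k.factorial) := by gcongr
    _ = _ := by ring

/-! ## Embedding a graph into a larger matrix of bits, including the diagonal -/

/-- The weights may miss mass `ε`, because on a bad diagonal no embedding exists. Since the errors
are at most 2, this costs only `2 * ε`. -/
lemma exists_le_of_sum_le {R : Type*} {s : Finset R} (hs : s.Nonempty) {w e : R → ℝ}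
    (hw : ∀ r ∈ s, 0 ≤ w r) (he : ∀ r ∈ s, e r ≤ 2) {ε X : ℝ} (hε : 0 < ε) (hX0 : 0 ≤ X)
    (hW : 1 - ε ≤ ∑ r ∈ s, w r) (hX : ∑ r ∈ s, w r * e r ≤ X) : ∃ r ∈ s, e r ≤ X + 2 * ε := by
  by_cases h2 : 2 ≤ X + 2 * ε
  · obtain ⟨r, hr⟩ := hs
    exact ⟨r, hr, (he r hr).trans h2⟩
  by_contra! h
  have h1 : (X + 2 * ε) * ∑ r ∈ s, w r ≤ ∑ r ∈ s, w r * e r := by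
    rw [Finset.mul_sum]
    refine Finset.sum_le_sum fun r hr => ?_
    rw [mul_comm]
    exact mul_le_mul_of_nonneg_left (h r hr).le (hw r hr)
  nlinarith

lemma exists_le_average {R : Type*} {s : Finset R} {w e : R → ℝ} {X : ℝ}
    (hw : ∀ r ∈ s, 0 ≤ w r) (hW : ∑ r ∈ s, w r = 1) (hX : ∑ r ∈ s, w r * e r ≤ X) :
    ∃ r ∈ s, e r ≤ X := by
  by_contra! h
  have h1 : ∑ r ∈ s, w r * X = X := by rw [← Finset.sum_mul, hW, one_mul]
  have h2 : ∃ r ∈ s, 0 < w r := by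
    by_contra! h3
    have : ∑ r ∈ s, w r ≤ 0 := Finset.sum_nonpos h3
    linarith
  obtain ⟨r, hr, hr'⟩ := h2
  have : ∑ r ∈ s, w r * X < ∑ r ∈ s, w r * e r :=
    Finset.sum_lt_sum (fun r hr => mul_le_mul_of_nonneg_left (h r hr).le (hw r hr))
      ⟨r, hr, mul_lt_mul_of_pos_left (h r hr) hr'⟩
  linarith

/-- The elements whose diagonal bit is `1`. -/
def diagOnes {V : Type*} [Fintype V] (b : Sym2 V → Bool) : Finset V :=
  Finset.univ.filter fun i => b s(i, i) = true

/-- Set all bits of pairs in `T` to `1`. -/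
def force {V : Type*} [DecidableEq V] (T : Finset V) (b : Sym2 V → Bool) (z : Sym2 V) : Bool :=
  b z || decide (z ∈ T.sym2)

lemma force_empty {V : Type*} [DecidableEq V] (b : Sym2 V → Bool) : force ∅ b = b := by
  funext z
  simp [force]

/-- The unordered pairs of distinct elements of the range of `ι`. -/
def InRange {n M : ℕ} (ι : Fin n ↪ Fin M) (z : Sym2 (Fin M)) : Prop :=
  ∃ y : Sym2 (Fin n), ¬ y.IsDiag ∧ y.map ι = z

open Classical in
/-- The matrix of bits that contains the adjacencies of `G` at the pairs of distinct elements of the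
range of `ι`, and the bits `x` elsewhere. -/
def embedBits {n M : ℕ} (ι : Fin n ↪ Fin M) (x : Sym2 (Fin M) → Bool) (G : SimpleGraph (Fin n))
    (z : Sym2 (Fin M)) : Bool :=
  if h : InRange ι z then decide (h.choose ∈ G.edgeSet) else x z

lemma mem_edgeSet_cliqueOn {n : ℕ} (S : Finset (Fin n)) (y : Sym2 (Fin n)) :
    y ∈ (cliqueOn S).edgeSet ↔ ¬ y.IsDiag ∧ y ∈ S.sym2 := by
  induction y with
  | _ u v =>
    simp [cliqueOn]
    tauto

lemma cliqueOn_empty {n : ℕ} : cliqueOn (∅ : Finset (Fin n)) = ⊥ := by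
  ext i j
  simp [cliqueOn]

lemma map_mem_sym2_map {n M : ℕ} (ι : Fin n ↪ Fin M) (S : Finset (Fin n)) (y : Sym2 (Fin n)) :
    y.map ι ∈ (S.map ι).sym2 ↔ y ∈ S.sym2 := by
  induction y with
  | _ u v => simp

lemma not_inRange_diag {n M : ℕ} (ι : Fin n ↪ Fin M) (i : Fin M) : ¬ InRange ι s(i, i) := by
  rintro ⟨y, hy, h⟩
  induction y with
  | _ u v =>
    simp only [Sym2.map_mk, Sym2.eq_iff, or_self] at h
    exact hy (by simpa using ι.injective (h.1.trans h.2.symm))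

open Classical in
lemma embedBits_map {n M : ℕ} (ι : Fin n ↪ Fin M) (x : Sym2 (Fin M) → Bool)
    (G : SimpleGraph (Fin n)) {y : Sym2 (Fin n)} (hy : ¬ y.IsDiag) :
    embedBits ι x G (y.map ι) = true ↔ y ∈ G.edgeSet := by
  have h : InRange ι (y.map ι) := ⟨y, hy, rfl⟩
  have h2 : h.choose = y := Sym2.map.injective ι.injective h.choose_spec.2
  rw [embedBits, dif_pos h, decide_eq_true_eq, h2]

lemma embedBits_of_not_inRange {n M : ℕ} {ι : Fin n ↪ Fin M} (x : Sym2 (Fin M) → Bool)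
    (G : SimpleGraph (Fin n)) {z : Sym2 (Fin M)} (hz : ¬ InRange ι z) :
    embedBits ι x G z = x z := dif_neg hz

-- The diagonal bits over the range of `ι` are already 1, so planting a clique in the graph acts as
-- forcing all pairs of its image, the diagonal ones included.
open Classical in
lemma embedBits_eq {n M : ℕ} (ι : Fin n ↪ Fin M) (a x : Sym2 (Fin M) → Bool) (S : Finset (Fin n))
    (hx : Finset.univ.map ι ⊆ diagOnes x) :
    embedBits ι x (bitGraph (a ∘ Sym2.map ι) ⊔ cliqueOn S) =
      force (S.map ι) fun z => if InRange ι z then a z else x z := by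
  funext z
  by_cases h : InRange ι z
  · obtain ⟨y, hy, rfl⟩ := h
    rw [Bool.eq_iff_iff, embedBits_map ι x _ hy, SimpleGraph.edgeSet_sup, Set.mem_union,
      mem_edgeSet_bitGraph, mem_edgeSet_cliqueOn, ← map_mem_sym2_map ι, Function.comp, force,
      if_pos ⟨y, hy, rfl⟩]
    simp [hy]
  · rw [embedBits_of_not_inRange x _ h, force, if_neg h]
    by_cases hz : z ∈ (S.map ι).sym2
    · have hxz : x z = true := by
        induction z with
        | _ i j =>
          simp only [Finset.mk_mem_sym2_iff, Finset.mem_map] at hz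
          obtain ⟨⟨u, hu, rfl⟩, v, hv, rfl⟩ := hz
          by_cases huv : u = v
          · subst huv
            have := hx (Finset.mem_map_of_mem ι (Finset.mem_univ u))
            simpa [diagOnes] using this
          · exact absurd ⟨s(u, v), by simpa using huv, by simp⟩ h
      simp [hxz]
    · simp [hz]

lemma coe_half : ((half : I) : ℝ) = 1 / 2 := rfl

/-- Graph bits and padding together form one uniform matrix `b`. Positions in range are never
diagonal, so the diagonal, and with it the weight, comes from the padding alone. -/
lemma sum_integral_embedBits {n M : ℕ} (ι : Fin n ↪ Fin M) (S : Finset (Fin n))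
    (w : Finset (Fin M) → ℝ) (F : (Sym2 (Fin M) → Bool) → ℝ) :
    ∑ x, bitsProb (fun _ => 1 / 2) x *
        (if Finset.univ.map ι ⊆ diagOnes x then w (diagOnes x) else 0) *
        ∫ G, F (embedBits ι x (G ⊔ cliqueOn S)) ∂(erdosRenyi n half) =
      ∑ b, bitsProb (fun _ => 1 / 2) b *
        (if Finset.univ.map ι ⊆ diagOnes b then w (diagOnes b) else 0) * F (force (S.map ι) b) := by
  classical
  have key := sum_sum_bitsProb (InRange ι) (fun _ => (1 / 2 : ℝ)) (fun _ => (1 / 2 : ℝ)) fun b =>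
    (if Finset.univ.map ι ⊆ diagOnes b then w (diagOnes b) else 0) * F (force (S.map ι) b)
  simp only [ite_self] at key
  have hD : ∀ a x : Sym2 (Fin M) → Bool,
      diagOnes (fun z => if InRange ι z then a z else x z) = diagOnes x := by
    intro a x
    simp [diagOnes, not_inRange_diag]
  simp only [hD] at key
  simp_rw [mul_assoc]
  rw [← key, Finset.sum_comm]
  refine Finset.sum_congr rfl fun x _ => ?_
  rw [integral_erdosRenyi half (Sym2.map ι) (Sym2.map.injective ι.injective).injOn, Finset.mul_sum,
    Finset.mul_sum]
  refine Finset.sum_congr rfl fun a _ => ?_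
  split_ifs with hx
  · rw [embedBits_eq ι a x S hx, coe_half]
    ring
  · simp

/-- A uniform diagonal is 1 on all of `T` with probability 2^(-|T|). Conditioning on this by the
density 2^|T| and then forcing the pairs in `T` produces the matrix planted on `T`. -/
lemma sum_bitsProb_force {M : ℕ} (T : Finset (Fin M)) (F : (Sym2 (Fin M) → Bool) → ℝ) :
    ∑ b, bitsProb (fun _ => 1 / 2) b * ((if T ⊆ diagOnes b then 2 ^ T.card else 0) *
      F (force T b)) =
      ∑ b, bitsProb (fun z => if z ∈ T.sym2 then 1 else 1 / 2) b * F b := by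
  classical
  -- The law conditioned on the diagonal of `T`, before the remaining pairs in `T` are forced.
  set ρ : Sym2 (Fin M) → ℝ := fun z => if z ∈ T.image Sym2.diag then 1 else 1 / 2 with hρ
  have key := sum_sum_bitsProb (fun z => z ∈ T.sym2) (fun _ => (1 : ℝ)) ρ F
  have h1 : (fun z => if z ∈ T.sym2 then 1 else ρ z) =
      fun z => if z ∈ T.sym2 then (1 : ℝ) else 1 / 2 := by
    funext z
    by_cases hz : z ∈ T.sym2
    · simp [hz]
    · have : z ∉ T.image Sym2.diag := by
        intro h
        rw [Finset.mem_image] at h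
        obtain ⟨i, hi, rfl⟩ := h
        exact hz (by simpa [Sym2.diag] using hi)
      simp only [hz, if_false, hρ, this]
  rw [h1] at key
  rw [← key]
  refine Eq.symm (Eq.trans (Finset.sum_eq_single (fun _ => true) ?_ (by simp)) ?_)
  · intro a _ ha
    have : ∃ z, a z = false := by
      by_contra! h
      exact ha (funext fun z => by simpa using h z)
    obtain ⟨z, hz⟩ := this
    have h2 : bitsProb (fun _ : Sym2 (Fin M) => (1 : ℝ)) a = 0 :=
      Finset.prod_eq_zero (Finset.mem_univ z) (by simp [bern, hz])
    simp only [h2, zero_mul, Finset.sum_const_zero]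
  · have h2 : bitsProb (fun _ : Sym2 (Fin M) => (1 : ℝ)) (fun _ => true) = 1 := by
      simp [bitsProb, bern]
    refine Finset.sum_congr rfl fun b _ => Eq.symm ?_
    rw [h2, one_mul, ← mul_assoc]
    have h3 : (fun z => if z ∈ T.sym2 then true else b z) = force T b := by
      funext z
      by_cases hz : z ∈ T.sym2 <;> simp [force, hz]
    rw [h3]
    congr 1
    have h4 : ∀ z, bern (ρ z) (b z) = bern (1 / 2) (b z) *
        (if z ∈ T.image Sym2.diag then (if b z = true then 2 else 0) else 1) := by
      intro z
      by_cases hz : z ∈ T.image Sym2.diag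
      · have : ρ z = 1 := if_pos hz
        rw [this, if_pos hz]
        cases hb : b z <;> simp [bern]
      · simp only [hρ, hz, if_false, mul_one]
    unfold bitsProb
    simp_rw [h4]
    rw [Finset.prod_mul_distrib, Fintype.prod_ite_mem, Finset.prod_image
      (fun i _ j _ h => Sym2.diag_injective h)]
    congr 1
    split_ifs with hT
    · rw [← Finset.prod_const]
      refine (Finset.prod_congr rfl fun i hi => ?_).symm
      have := hT hi
      simp only [diagOnes, Finset.mem_filter, Finset.mem_univ, true_and] at this
      simp [Sym2.diag, this]
    · rw [Finset.not_subset] at hT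
      obtain ⟨i, hi, hb⟩ := hT
      simp only [diagOnes, Finset.mem_filter, Finset.mem_univ, true_and] at hb
      symm
      apply Finset.prod_eq_zero hi
      simp [Sym2.diag, hb]

open Classical in
lemma sum_bitsProb_diagOnes_le {M : ℕ} {t : ℝ} (ht : 0 < t) :
    ∑ b : Sym2 (Fin M) → Bool, bitsProb (fun _ => 1 / 2) b *
      (if (M : ℝ) / 2 - t ≤ (diagOnes b).card then 0 else 1) ≤ M / (4 * t ^ 2) := by
  have h := sum_bitsProb_le_div (ρ := fun _ : Sym2 (Fin M) => (1 / 2 : ℝ))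
    (fun _ => by norm_num) (Finset.univ.image Sym2.diag) ht
  rw [Finset.card_image_of_injective _ Sym2.diag_injective, Finset.card_univ, Fintype.card_fin] at h
  refine le_trans (Finset.sum_le_sum fun b _ => mul_le_mul_of_nonneg_left ?_
    (bitsProb_nonneg (fun _ => by norm_num) b)) h
  have h2 : ∑ e ∈ Finset.univ.image Sym2.diag, (bit (b e) - 1 / 2) =
      ((diagOnes b).card : ℝ) - M / 2 := by
    rw [Finset.sum_image (fun i _ j _ h => Sym2.diag_injective h), Finset.sum_sub_distrib]
    have h3 : ((diagOnes b).card : ℝ) = ∑ i, bit (b s(i, i)) := by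
      unfold diagOnes bit
      rw [Finset.sum_boole]
    rw [h3]
    simp [Sym2.diag]
    ring
  rw [h2]
  split_ifs with h3 h4 h4
  · norm_num
  · norm_num
  · norm_num
  · exfalso
    apply h4
    rw [abs_of_nonpos] <;> linarith

lemma exists_emb {n M : ℕ} (h : n ≤ M) : ∃ emb : Finset (Fin M) → (Fin n ↪ Fin M),
    ∀ E, E.card = n → Finset.univ.map (emb E) = E := by
  have key : ∀ E : Finset (Fin M), ∃ ι : Fin n ↪ Fin M, E.card = n → Finset.univ.map ι = E := by
    intro E
    by_cases hE : E.card = n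
    · refine ⟨(E.orderEmbOfFin hE).toEmbedding, fun _ => ?_⟩
      apply Finset.coe_injective
      simp
    · exact ⟨Fin.castLEEmb h, fun h => absurd h hE⟩
  choose emb hemb using key
  exact ⟨emb, hemb⟩

lemma sum_powersetCard_ite {V : Type*} [Fintype V] [DecidableEq V] (n : ℕ) (D : Finset V)
    (c : ℝ) (g : Finset V → ℝ) :
    ∑ E ∈ (Finset.univ : Finset V).powersetCard n, (if E ⊆ D then c else 0) * g E =
      c * ∑ E ∈ D.powersetCard n, g E := by
  rw [Finset.mul_sum]
  simp_rw [ite_mul, zero_mul]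
  rw [← Finset.sum_filter]
  refine Finset.sum_congr ?_ fun _ _ => rfl
  ext E
  simp only [Finset.mem_filter, Finset.mem_powersetCard, Finset.subset_univ, true_and]
  exact and_comm

lemma average_mem_Icc {R : Type*} {s : Finset R} {c : ℝ} (hs : (s.card : ℝ) = c) {f : R → ℝ}
    (h0 : ∀ r ∈ s, 0 ≤ f r) (h1 : ∀ r ∈ s, f r ≤ 1) : c⁻¹ * ∑ r ∈ s, f r ∈ Set.Icc (0 : ℝ) 1 := by
  subst hs
  refine ⟨mul_nonneg (by positivity) (Finset.sum_nonneg h0), ?_⟩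
  have := Finset.sum_le_card_nsmul s f 1 h1
  simp only [nsmul_eq_mul, mul_one] at this
  exact inv_mul_le_one_of_le₀ this (by positivity)

lemma integral_le_one_of_le {n : ℕ} (μ : Measure (SimpleGraph (Fin n))) [IsProbabilityMeasure μ]
    {F : SimpleGraph (Fin n) → ℝ} (h : ∀ G, F G ≤ 1) : ∫ G, F G ∂μ ≤ 1 := by
  calc _ ≤ ∫ _, (1 : ℝ) ∂μ := integral_mono .of_finite .of_finite h
    _ = 1 := by simp

lemma integral_plantedClique_le_one {n k : ℕ} (p : I) {F : SimpleGraph (Fin n) → ℝ}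
    (h0 : ∀ G, 0 ≤ F G) (h1 : ∀ G, F G ≤ 1) : ∫ G, F G ∂(plantedClique n k p) ≤ 1 := by
  rw [integral_plantedClique]
  refine (average_mem_Icc (by simp) (fun S _ => ?_) fun S _ => ?_).2
  · exact integral_nonneg fun G => h0 _
  · exact integral_le_one_of_le _ fun G => h1 _

set_option maxHeartbeats 800000 in
/-- The planted clique problem reduces to the corresponding problem for matrices of bits in which
the diagonal is planted, too. -/
lemma exists_embedBits_reduction {n k M : ℕ} (hkn : k ≤ n) {t : ℝ} (ht : 0 < t) (hM : 0 < M)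
    (hn : (n : ℝ) ≤ M / 2 - t) {Λ₁ Λ₀ : (Sym2 (Fin M) → Bool) → ℝ}
    (h1 : ∀ b, Λ₁ b ∈ Set.Icc (0 : ℝ) 1) (h0 : ∀ b, Λ₀ b ∈ Set.Icc (0 : ℝ) 1) :
    ∃ (ι : Fin n ↪ Fin M) (x : Sym2 (Fin M) → Bool),
      ∫ G, Λ₁ (embedBits ι x G) ∂(erdosRenyi n half) +
        ∫ G, Λ₀ (embedBits ι x G) ∂(plantedClique n k half) ≤
      ∑ b, bitsProb (fun _ => 1 / 2) b * Λ₁ b +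
        (M.choose k : ℝ)⁻¹ * ∑ T ∈ Finset.univ.powersetCard k,
          ∑ b, bitsProb (fun z => if z ∈ T.sym2 then 1 else 1 / 2) b * Λ₀ b +
        (2 * k * (t + k) / M + 3 * (M / (4 * t ^ 2))) := by
  classical
  have hM' : (0 : ℝ) < M := by exact_mod_cast hM
  have hnM : n ≤ M := by
    rw [← Nat.cast_le (α := ℝ)]
    linarith
  obtain ⟨emb, hemb⟩ := exists_emb hnM
  set ε : ℝ := M / (4 * t ^ 2) with hε
  have hε0 : 0 < ε := by positivity
  set u : (Sym2 (Fin M) → Bool) → ℝ := fun b => bitsProb (fun _ => 1 / 2) b with hu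
  have hu0 : ∀ b, 0 ≤ u b := fun b => bitsProb_nonneg (fun _ => by norm_num) b
  have hu1 : ∑ b, u b = 1 := sum_bitsProb _
  -- The weight that makes the image of the embedding a uniform n-subset of the indices with
  -- diagonal bit 1.
  set c : Finset (Fin M) → ℝ := fun D => (D.card.choose n : ℝ)⁻¹ with hc
  have hc0 : ∀ D, 0 ≤ c D := fun D => by positivity
  set s := (Finset.univ : Finset (Fin M)).powersetCard n with hs
  set X₁ := ∑ b, u b * Λ₁ b with hX₁
  set X₀ := (M.choose k : ℝ)⁻¹ * ∑ T ∈ (Finset.univ : Finset (Fin M)).powersetCard k,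
          ∑ b, bitsProb (fun z => if z ∈ T.sym2 then 1 else 1 / 2) b * Λ₀ b with hX₀
  have hX₁0 : 0 ≤ X₁ := Finset.sum_nonneg fun b _ => mul_nonneg (hu0 b) (h1 b).1
  have hX₀0 : 0 ≤ X₀ := mul_nonneg (by positivity) (Finset.sum_nonneg fun T _ =>
    Finset.sum_nonneg fun b _ => mul_nonneg (bitsProb_nonneg (fun z => by
      split_ifs <;> norm_num) b) (h0 b).1)
  -- the event that there are sufficiently many ones on the diagonal
  have hgood : ∀ b : Sym2 (Fin M) → Bool, (M : ℝ) / 2 - t ≤ (diagOnes b).card →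
      n ≤ (diagOnes b).card := by
    intro b hb
    rw [← Nat.cast_le (α := ℝ)]
    linarith
  have hbad := sum_bitsProb_diagOnes_le (M := M) ht
  have havg : ∀ D : Finset (Fin M), c D * ∑ E ∈ D.powersetCard n, (1 : ℝ) =
      if n ≤ D.card then 1 else 0 := by
    intro D
    simp only [hc, Finset.sum_const, Finset.card_powersetCard, nsmul_eq_mul, mul_one]
    split_ifs with h
    · exact inv_mul_cancel₀ (by exact_mod_cast (Nat.choose_pos h).ne')
    · simp [Nat.choose_eq_zero_of_lt (not_le.1 h)]
  have hW : 1 - ε ≤ ∑ r ∈ s ×ˢ (Finset.univ : Finset (Sym2 (Fin M) → Bool)),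
      u r.2 * (if r.1 ⊆ diagOnes r.2 then c (diagOnes r.2) else 0) := by
    rw [Finset.sum_product_right]
    have e1 : ∀ b, ∑ E ∈ s, u b * (if E ⊆ diagOnes b then c (diagOnes b) else 0) =
        u b * if n ≤ (diagOnes b).card then 1 else 0 := by
      intro b
      rw [← Finset.mul_sum, ← havg, ← sum_powersetCard_ite n (diagOnes b) _ fun _ => 1]
      simp only [mul_one, hs]
    simp only [e1]
    have e2 : 1 - ∑ b, u b * (if (M : ℝ) / 2 - t ≤ (diagOnes b).card then 0 else 1) ≤
        ∑ b, u b * if n ≤ (diagOnes b).card then (1 : ℝ) else 0 := by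
      rw [sub_le_iff_le_add, ← Finset.sum_add_distrib]
      refine hu1.symm.le.trans (Finset.sum_le_sum fun b _ => ?_)
      have := hu0 b
      by_cases hb : (M : ℝ) / 2 - t ≤ (diagOnes b).card
      · simp only [hb, hgood b hb, if_true]
        linarith
      · simp only [hb, if_false]
        split_ifs <;> linarith
    linarith
  -- the error of a typical embedding
  have hfix : ∀ (F : (Sym2 (Fin M) → Bool) → ℝ) (S : Finset (Fin n)),
      ∑ E ∈ s, ∑ x, u x * (if E ⊆ diagOnes x then c (diagOnes x) else 0) *
        ∫ G, F (embedBits (emb E) x (G ⊔ cliqueOn S)) ∂(erdosRenyi n half) =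
      ∑ b, u b * (c (diagOnes b) * ∑ E ∈ (diagOnes b).powersetCard n,
        F (force (S.map (emb E)) b)) := by
    intro F S
    have e1 : ∀ E ∈ s, ∑ x, u x * (if E ⊆ diagOnes x then c (diagOnes x) else 0) *
        ∫ G, F (embedBits (emb E) x (G ⊔ cliqueOn S)) ∂(erdosRenyi n half) =
        ∑ b, u b * (if E ⊆ diagOnes b then c (diagOnes b) else 0) *
          F (force (S.map (emb E)) b) := by
      intro E hE
      have hE' := hemb E (Finset.mem_powersetCard.1 hE).2
      have := sum_integral_embedBits (emb E) S c F
      rwa [hE'] at this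
    rw [Finset.sum_congr rfl e1, Finset.sum_comm]
    refine Finset.sum_congr rfl fun b _ => ?_
    rw [← sum_powersetCard_ite, Finset.mul_sum]
    exact Finset.sum_congr rfl fun E _ => mul_assoc _ _ _
  -- Under the null hypothesis the embedded matrix is uniform; only diagonals with fewer than `n`
  -- ones are lost.
  have hE1 : ∑ E ∈ s, ∑ x, u x * (if E ⊆ diagOnes x then c (diagOnes x) else 0) *
      ∫ G, Λ₁ (embedBits (emb E) x G) ∂(erdosRenyi n half) ≤ X₁ := by
    have := hfix Λ₁ ∅
    simp only [cliqueOn_empty, sup_bot_eq, Finset.map_empty, force_empty] at this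
    rw [this]
    refine Finset.sum_le_sum fun b _ => mul_le_mul_of_nonneg_left ?_ (hu0 b)
    have e1 : ∑ E ∈ (diagOnes b).powersetCard n, Λ₁ b =
        (∑ E ∈ (diagOnes b).powersetCard n, (1 : ℝ)) * Λ₁ b := by
      rw [Finset.sum_mul]
      simp
    rw [e1, ← mul_assoc, havg]
    split_ifs
    · rw [one_mul]
    · rw [zero_mul]; exact (h1 b).1
  -- The average of `Λ₀` when a uniform k-set among the ones of the diagonal is planted in `b`. A
  -- random k-subset of a random n-subset is of this kind, whence `hE0`.
  set Y : (Sym2 (Fin M) → Bool) → ℝ := fun b => ((diagOnes b).card.choose k : ℝ)⁻¹ *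
    ∑ T ∈ (diagOnes b).powersetCard k, Λ₀ (force T b) with hY
  have hY01 : ∀ b, Y b ∈ Set.Icc (0 : ℝ) 1 := fun b =>
    average_mem_Icc (by simp) (fun T _ => (h0 _).1) fun T _ => (h0 _).2
  have hE0 : ∑ E ∈ s, ∑ x, u x * (if E ⊆ diagOnes x then c (diagOnes x) else 0) *
      ∫ G, Λ₀ (embedBits (emb E) x G) ∂(plantedClique n k half) =
        ∑ b, u b * if n ≤ (diagOnes b).card then Y b else 0 := by
    calc _ = (n.choose k : ℝ)⁻¹ * ∑ S ∈ (Finset.univ : Finset (Fin n)).powersetCard k,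
          ∑ E ∈ s, ∑ x, u x * (if E ⊆ diagOnes x then c (diagOnes x) else 0) *
            ∫ G, Λ₀ (embedBits (emb E) x (G ⊔ cliqueOn S)) ∂(erdosRenyi n half) := by
          have e1 : ∀ (E : Finset (Fin M)) x, u x * (if E ⊆ diagOnes x then c (diagOnes x) else 0) *
              ∫ G, Λ₀ (embedBits (emb E) x G) ∂(plantedClique n k half) = (n.choose k : ℝ)⁻¹ *
              ∑ S ∈ (Finset.univ : Finset (Fin n)).powersetCard k,
                u x * (if E ⊆ diagOnes x then c (diagOnes x) else 0) *
                ∫ G, Λ₀ (embedBits (emb E) x (G ⊔ cliqueOn S)) ∂(erdosRenyi n half) := by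
            intro E x
            rw [integral_plantedClique, ← Finset.mul_sum]
            ring
          simp_rw [e1, ← Finset.mul_sum _ _ ((n.choose k : ℝ)⁻¹)]
          congr 1
          rw [Finset.sum_congr rfl fun E _ => Finset.sum_comm, Finset.sum_comm]
      _ = ∑ b, u b * (c (diagOnes b) * ∑ E ∈ (diagOnes b).powersetCard n, (n.choose k : ℝ)⁻¹ *
            ∑ S ∈ (Finset.univ : Finset (Fin n)).powersetCard k, Λ₀ (force (S.map (emb E)) b)) := by
          simp_rw [hfix]
          rw [Finset.sum_comm, Finset.mul_sum]
          refine Finset.sum_congr rfl fun b _ => ?_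
          rw [← Finset.mul_sum, ← Finset.mul_sum, ← Finset.mul_sum, Finset.sum_comm]
          ring
      _ = _ := by
          refine Finset.sum_congr rfl fun b _ => ?_
          congr 1
          have e1 : ∀ E ∈ (diagOnes b).powersetCard n, (n.choose k : ℝ)⁻¹ *
              ∑ S ∈ (Finset.univ : Finset (Fin n)).powersetCard k, Λ₀ (force (S.map (emb E)) b) =
              (n.choose k : ℝ)⁻¹ * ∑ T ∈ E.powersetCard k, Λ₀ (force T b) := by
            intro E hE
            have hE' := hemb E (Finset.mem_powersetCard.1 hE).2
            conv_rhs => rw [← hE', Finset.powersetCard_map, Finset.sum_map]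
            rfl
          rw [Finset.sum_congr rfl e1]
          split_ifs with hb
          · exact sum_powersetCard_powersetCard _ hkn hb fun T => Λ₀ (force T b)
          · rw [Finset.powersetCard_eq_empty.2 (not_le.1 hb)]
            simp
  have hcM : (0 : ℝ) < M.choose k := by exact_mod_cast Nat.choose_pos (hkn.trans hnM)
  -- The target plants a uniform k-set first. Seen from `b`, this is the same average `Y` with
  -- density 2^k (d choose k) / (M choose k), where d is the number of ones on the diagonal.
  have hT : X₀ = ∑ b, u b * ((2 ^ k * (diagOnes b).card.choose k / M.choose k : ℝ) * Y b) := by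
    have e1 : ∀ T ∈ (Finset.univ : Finset (Fin M)).powersetCard k,
        ∑ b, bitsProb (fun z => if z ∈ T.sym2 then 1 else 1 / 2) b * Λ₀ b =
        ∑ b, u b * ((if T ⊆ diagOnes b then 2 ^ k else 0) * Λ₀ (force T b)) := by
      intro T hT
      rw [← sum_bitsProb_force, (Finset.mem_powersetCard.1 hT).2]
    rw [hX₀, Finset.sum_congr rfl e1, Finset.sum_comm, Finset.mul_sum]
    refine Finset.sum_congr rfl fun b _ => ?_
    rw [← Finset.mul_sum, sum_powersetCard_ite]
    simp only [hY]
    by_cases hb : k ≤ (diagOnes b).card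
    · have : ((diagOnes b).card.choose k : ℝ) ≠ 0 := by exact_mod_cast (Nat.choose_pos hb).ne'
      field_simp
    · rw [Finset.powersetCard_eq_empty.2 (not_le.1 hb)]
      simp
  -- On good diagonals the density is at least 1 - 2k(t + k) / M; bad ones cost at most their
  -- probability `ε`.
  have hcomp : ∑ b, u b * (if n ≤ (diagOnes b).card then Y b else 0) ≤
      X₀ + 2 * k * (t + k) / M + ε := by
    have e1 : ∑ b, u b * (if n ≤ (diagOnes b).card then Y b else 0) ≤
        ∑ b, (u b * ((2 ^ k * (diagOnes b).card.choose k / M.choose k : ℝ) * Y b) +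
          u b * (2 * k * (t + k) / M) +
          u b * (if (M : ℝ) / 2 - t ≤ (diagOnes b).card then 0 else 1)) := by
      refine Finset.sum_le_sum fun b _ => ?_
      rw [← mul_add, ← mul_add]
      refine mul_le_mul_of_nonneg_left ?_ (hu0 b)
      have hYb := hY01 b
      have hε1 : 0 ≤ 2 * (k : ℝ) * (t + k) / M := by positivity
      by_cases hb : (M : ℝ) / 2 - t ≤ (diagOnes b).card
      · have e2 := one_sub_mul_choose_le (k := k) ht.le hM hb
        rw [← le_div_iff₀ hcM] at e2
        simp only [hgood b hb, hb, if_true, add_zero]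
        nlinarith [mul_le_mul_of_nonneg_right e2 hYb.1, mul_le_mul_of_nonneg_left hYb.2 hε1]
      · have e3 : (0 : ℝ) ≤ 2 ^ k * (diagOnes b).card.choose k / M.choose k * Y b :=
          mul_nonneg (by positivity) hYb.1
        simp only [hb, if_false]
        split_ifs
        · linarith [hYb.2]
        · linarith
    refine e1.trans ?_
    rw [Finset.sum_add_distrib, Finset.sum_add_distrib, ← hT, ← Finset.sum_mul, hu1]
    linarith
  have hne : (s ×ˢ (Finset.univ : Finset (Sym2 (Fin M) → Bool))).Nonempty :=
    (Finset.powersetCard_nonempty.2 (by simpa using hnM)).product Finset.univ_nonempty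
  set e : Finset (Fin M) × (Sym2 (Fin M) → Bool) → ℝ := fun r =>
    ∫ G, Λ₁ (embedBits (emb r.1) r.2 G) ∂(erdosRenyi n half) +
        ∫ G, Λ₀ (embedBits (emb r.1) r.2 G) ∂(plantedClique n k half) with he
  set w : Finset (Fin M) × (Sym2 (Fin M) → Bool) → ℝ := fun r =>
    u r.2 * (if r.1 ⊆ diagOnes r.2 then c (diagOnes r.2) else 0) with hw
  have hw0 : ∀ r ∈ s ×ˢ (Finset.univ : Finset (Sym2 (Fin M) → Bool)), 0 ≤ w r := by
    intro r _
    simp only [hw]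
    refine mul_nonneg (hu0 _) ?_
    split_ifs
    exacts [hc0 _, le_rfl]
  have he2 : ∀ r ∈ s ×ˢ (Finset.univ : Finset (Sym2 (Fin M) → Bool)), e r ≤ 2 := by
    intro r _
    simp only [he]
    have a1 := integral_le_one_of_le (erdosRenyi n half)
      (F := fun G => Λ₁ (embedBits (emb r.1) r.2 G)) fun G => (h1 _).2
    have a2 := integral_plantedClique_le_one (k := k) half
      (F := fun G => Λ₀ (embedBits (emb r.1) r.2 G)) (fun G => (h0 _).1) fun G => (h0 _).2
    linarith
  have hsum : ∑ r ∈ s ×ˢ (Finset.univ : Finset (Sym2 (Fin M) → Bool)), w r * e r ≤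
      X₁ + (X₀ + 2 * k * (t + k) / M + ε) := by
    have hd : ∑ r ∈ s ×ˢ (Finset.univ : Finset (Sym2 (Fin M) → Bool)), w r * e r =
        ∑ E ∈ s, ∑ x, u x * (if E ⊆ diagOnes x then c (diagOnes x) else 0) *
          ∫ G, Λ₁ (embedBits (emb E) x G) ∂(erdosRenyi n half) +
        ∑ E ∈ s, ∑ x, u x * (if E ⊆ diagOnes x then c (diagOnes x) else 0) *
          ∫ G, Λ₀ (embedBits (emb E) x G) ∂(plantedClique n k half) := by
      rw [Finset.sum_product, ← Finset.sum_add_distrib]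
      refine Finset.sum_congr rfl fun E _ => ?_
      rw [← Finset.sum_add_distrib]
      exact Finset.sum_congr rfl fun x _ => mul_add _ _ _
    rw [hd, hE0]
    linarith
  have hX : 0 ≤ X₁ + (X₀ + 2 * k * (t + k) / M + ε) := by
    have : 0 ≤ 2 * (k : ℝ) * (t + k) / M := by positivity
    linarith
  -- Together with the `ε` of `hcomp`, the `2 * ε` lost here gives the constant 3.
  obtain ⟨r, -, hr⟩ := exists_le_of_sum_le hne hw0 he2 hε0 hX hW hsum
  refine ⟨emb r.1, r.2, hr.trans (le_of_eq ?_)⟩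
  ring

/-! ## The reduction -/

/-- Once all random choices are fixed, an output pair depends on at most one input pair. The values
of `c₁` and `c₀` there make it constant, a copy or a negation. -/
lemma isLocal_bitGraph {n M N : ℕ} (ι : Fin n ↪ Fin M) (x : Sym2 (Fin M) → Bool)
    (blk : Sym2 (Fin N) → Sym2 (Fin M)) (c₁ c₀ : Sym2 (Fin N) → Bool) :
    IsLocal fun G : SimpleGraph (Fin n) =>
      bitGraph fun e => if embedBits ι x G (blk e) then c₁ e else c₀ e := by
  intro i j
  by_cases hij : i = j
  · exact Or.inl ⟨False, fun G => by simp [bitGraph, hij]⟩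
  by_cases hz : InRange ι (blk s(i, j))
  · obtain ⟨y, hy, hyz⟩ := hz
    have hG : ∀ G : SimpleGraph (Fin n), embedBits ι x G (blk s(i, j)) = true ↔ y ∈ G.edgeSet := by
      intro G
      rw [← hyz]
      exact embedBits_map ι x G hy
    induction y with
    | _ u v =>
      simp only [SimpleGraph.mem_edgeSet] at hG
      cases h1 : c₁ s(i, j) <;> cases h0 : c₀ s(i, j)
      · exact Or.inl ⟨False, fun G => by simp [bitGraph, h1, h0]⟩
      · refine Or.inr (Or.inr ⟨u, v, fun G => ?_⟩)
        rw [← hG]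
        simp [bitGraph, h1, h0, hij]
      · refine Or.inr (Or.inl ⟨u, v, fun G => ?_⟩)
        rw [← hG]
        simp [bitGraph, h1, h0, hij]
      · exact Or.inl ⟨True, fun G => by simp [bitGraph, h1, h0, hij]⟩
  · refine Or.inl ⟨(if x (blk s(i, j)) then c₁ s(i, j) else c₀ s(i, j)) = true, fun G => ?_⟩
    simp only [bitGraph, embedBits_of_not_inRange x G hz]
    simp [hij]

namespace LiftKernel

variable {E Z : Type*} [Fintype E] [DecidableEq E] [Fintype Z] [DecidableEq Z] {blk : E → Z}
  {p η : ℝ} (κ : LiftKernel blk p η)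

/-- The two families of bits of a random block can be fixed. -/
lemma exists_le {n : ℕ} (μ₁ μ₀ : Measure (SimpleGraph (Fin n))) [IsFiniteMeasure μ₁]
    [IsFiniteMeasure μ₀] (b : SimpleGraph (Fin n) → Z → Bool) (Ψ₁ Ψ₀ : (E → Bool) → ℝ) :
    ∃ c₁ c₀ : E → Bool,
      ∫ G, Ψ₁ (fun e => if b G (blk e) then c₁ e else c₀ e) ∂μ₁ +
        ∫ G, Ψ₀ (fun e => if b G (blk e) then c₁ e else c₀ e) ∂μ₀ ≤
      ∫ G, ∑ h, κ.law (b G) h * Ψ₁ h ∂μ₁ + ∫ G, ∑ h, κ.law (b G) h * Ψ₀ h ∂μ₀ := by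
  have key : ∀ (μ : Measure (SimpleGraph (Fin n))) [IsFiniteMeasure μ] (Ψ : (E → Bool) → ℝ),
      ∑ c : (E → Bool) × (E → Bool), κ.law (fun _ => true) c.1 * κ.law (fun _ => false) c.2 *
        ∫ G, Ψ (fun e => if b G (blk e) then c.1 e else c.2 e) ∂μ =
      ∫ G, ∑ h, κ.law (b G) h * Ψ h ∂μ := by
    intro μ _ Ψ
    simp_rw [← integral_const_mul]
    rw [← integral_finsetSum _ fun _ _ => .of_finite]
    refine integral_congr_ae (Eventually.of_forall fun G => ?_)
    simp only
    rw [← κ.sum_law_eq, Fintype.sum_prod_type]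
  obtain ⟨c, -, hc⟩ := exists_le_average (s := Finset.univ)
    (w := fun c : (E → Bool) × (E → Bool) => κ.law (fun _ => true) c.1 * κ.law (fun _ => false) c.2)
    (e := fun c => ∫ G, Ψ₁ (fun e => if b G (blk e) then c.1 e else c.2 e) ∂μ₁ +
        ∫ G, Ψ₀ (fun e => if b G (blk e) then c.1 e else c.2 e) ∂μ₀)
    (X := ∫ G, ∑ h, κ.law (b G) h * Ψ₁ h ∂μ₁ + ∫ G, ∑ h, κ.law (b G) h * Ψ₀ h ∂μ₀)
    (fun c _ => mul_nonneg (κ.law_nonneg _ _) (κ.law_nonneg _ _))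
    (by
      rw [Fintype.sum_prod_type]
      simp only [← Finset.mul_sum, κ.sum_law, mul_one])
    (by
      simp only [mul_add, Finset.sum_add_distrib]
      rw [key, key])
  exact ⟨c.1, c.2, hc⟩

end LiftKernel

/-- The vertices of `Fin (M * m)` in the groups of `T`, for a division into `M` groups of size `m`. -/
def groups {M : ℕ} (m : ℕ) (T : Finset (Fin M)) : Finset (Fin (M * m)) :=
  Finset.univ.filter fun y => (finProdFinEquiv.symm y).1 ∈ T

lemma card_groups {M : ℕ} (m : ℕ) (T : Finset (Fin M)) : (groups m T).card = T.card * m := by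
  have : groups m T = (T ×ˢ (Finset.univ : Finset (Fin m))).map finProdFinEquiv.toEmbedding := by
    ext y
    obtain ⟨z, rfl⟩ := finProdFinEquiv.surjective y
    simp only [groups, Finset.mem_filter, Finset.mem_univ, true_and, Finset.mem_map_equiv,
      Equiv.symm_apply_apply, Finset.mem_product, and_true]
  rw [this, Finset.card_map, Finset.card_product, Finset.card_univ, Fintype.card_fin]

lemma card_fiber_sym2_map_le {V W : Type*} [Fintype V] [DecidableEq V] [DecidableEq W] {f : V → W}
    {m : ℕ} (hf : ∀ w, (Finset.univ.filter fun v => f v = w).card ≤ m) (z : Sym2 W) :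
    Fintype.card {e : Sym2 V // e.map f = z} ≤ m ^ 2 := by
  rw [Fintype.card_subtype]
  induction z with
  | _ i j =>
    have hsub : (Finset.univ.filter fun e : Sym2 V => e.map f = s(i, j)) ⊆
        ((Finset.univ.filter fun v => f v = i) ×ˢ (Finset.univ.filter fun v => f v = j)).image
          Sym2.mk.uncurry := by
      intro e he
      induction e with
      | _ x y =>
        simp only [Finset.mem_filter, Finset.mem_univ, true_and, Sym2.map_mk, Sym2.eq_iff] at he
        simp only [Finset.mem_image, Finset.mem_product, Finset.mem_filter, Finset.mem_univ,
          true_and, Prod.exists, Function.uncurry_apply_pair]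
        rcases he with ⟨hx, hy⟩ | ⟨hx, hy⟩
        · exact ⟨x, y, ⟨hx, hy⟩, rfl⟩
        · exact ⟨y, x, ⟨hy, hx⟩, Sym2.eq_swap⟩
    refine (Finset.card_le_card hsub).trans (Finset.card_image_le.trans ?_)
    rw [Finset.card_product, sq]
    exact Nat.mul_le_mul (hf i) (hf j)

/-- Planted clique reduces to planted dense subgraphs with smaller edge density, by a local map. -/
lemma exists_local_reduction {n k M m j : ℕ} {δ t : ℝ} (hkn : k ≤ n) (ht : 0 < t) (hM : 0 < M)
    (hn : (n : ℝ) ≤ M / 2 - t) (hδ0 : 0 ≤ δ) (hj : 2 ≤ j) (hm : 0 < m) (hδ : 2 * j * δ * m ≤ 1)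
    {p : I} (hp : (p : ℝ) = 1 / 2 + δ) {φ₁ φ₀ : SimpleGraph (Fin (M * m)) → ℝ}
    (h1 : ∀ G, φ₁ G ∈ Set.Icc (0 : ℝ) 1) (h0 : ∀ G, φ₀ G ∈ Set.Icc (0 : ℝ) 1) :
    ∃ F : SimpleGraph (Fin n) → SimpleGraph (Fin (M * m)), IsLocal F ∧
      ∫ G, φ₁ (F G) ∂(erdosRenyi n half) + ∫ G, φ₀ (F G) ∂(plantedClique n k half) ≤
        ∫ G, φ₁ G ∂(erdosRenyi (M * m) half) +
          ∫ G, φ₀ G ∂(plantedDense (M * m) (k * m) p half) +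
          (2 * k * (t + k) / M + 3 * (M / (4 * t ^ 2)) + k ^ 2 * (4 / 2 ^ j)) := by
  have hnM : n ≤ M := by
    rw [← Nat.cast_le (α := ℝ)]
    have : (0 : ℝ) ≤ M := by positivity
    linarith
  have hj' : (2 : ℝ) ≤ j := by exact_mod_cast hj
  have hm' : (1 : ℝ) ≤ m := by exact_mod_cast hm
  have hδ1 : 2 * δ ≤ 1 := by
    have : 2 * δ ≤ 2 * j * δ * m := by
      have h2 : δ * 1 ≤ δ * (j * m) := mul_le_mul_of_nonneg_left (by nlinarith) hδ0
      nlinarith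
    linarith
  have hη0 : (0 : ℝ) ≤ 4 / 2 ^ j := by positivity
  have hη1 : (4 : ℝ) / 2 ^ j ≤ 1 := by
    rw [div_le_one (by positivity)]
    calc (4 : ℝ) = 2 ^ 2 := by norm_num
      _ ≤ 2 ^ j := pow_le_pow_right₀ (by norm_num) hj
  have hpI : 1 / 2 + δ ∈ Set.Icc (0 : ℝ) 1 := hp ▸ p.2
  have hcM : (M.choose k : ℝ) ≠ 0 := by exact_mod_cast (Nat.choose_pos (hkn.trans hnM)).ne'
  -- choose the labels of the vertices
  obtain ⟨g, -, hg⟩ : ∃ g ∈ (Finset.univ : Finset (Equiv.Perm (Fin (M * m)))),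
      (M.choose k : ℝ)⁻¹ * ∑ T ∈ (Finset.univ : Finset (Fin M)).powersetCard k,
        ∑ h, bitsProb (denseProb p (1 / 2) ((groups m T).map g.toEmbedding)) h *
          φ₀ (bitGraph h) ≤ ∫ G, φ₀ G ∂(plantedDense (M * m) (k * m) p half) := by
    refine exists_le_average (w := fun _ => ((M * m).factorial : ℝ)⁻¹) (fun _ _ => by positivity)
      ?_ (le_of_eq ?_)
    · rw [Finset.sum_const, Finset.card_univ, Fintype.card_perm, Fintype.card_fin, nsmul_eq_mul]
      exact mul_inv_cancel₀ (by exact_mod_cast Nat.factorial_ne_zero _)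
    · rw [← Finset.mul_sum, ← Finset.mul_sum, Finset.sum_comm, mul_left_comm, Finset.mul_sum]
      have e1 : ∀ T ∈ (Finset.univ : Finset (Fin M)).powersetCard k,
          ((M * m).factorial : ℝ)⁻¹ * ∑ g : Equiv.Perm (Fin (M * m)),
            ∑ h, bitsProb (denseProb p (1 / 2) ((groups m T).map g.toEmbedding)) h *
              φ₀ (bitGraph h) = ∫ G, φ₀ G ∂(plantedDense (M * m) (k * m) p half) := by
        intro T hT
        have hc : (groups m T).card = k * m := by
          rw [card_groups, (Finset.mem_powersetCard.1 hT).2]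
        have := sum_perm_map hc fun S => ∑ h, bitsProb (denseProb p (1 / 2) S) h * φ₀ (bitGraph h)
        rw [Fintype.card_fin] at this
        rw [this, integral_plantedDense, coe_half]
      rw [Finset.sum_congr rfl e1, Finset.sum_const, Finset.card_powersetCard, Finset.card_univ,
        Fintype.card_fin, nsmul_eq_mul, inv_mul_cancel_left₀ hcM]
  set f : Fin (M * m) → Fin M := fun y => (finProdFinEquiv.symm (g.symm y)).1 with hf
  have hfm : ∀ i, (Finset.univ.filter fun y => f y = i).card ≤ m := by
    intro i
    have : (Finset.univ.filter fun y => f y = i) = (groups m {i}).map g.toEmbedding := by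
      ext y
      obtain ⟨y, rfl⟩ := g.surjective y
      simp [groups, hf]
    rw [this, Finset.card_map, card_groups]
    simp
  obtain ⟨κ⟩ := nonempty_liftKernel (Sym2.map f) hδ0 hδ1 (by omega : j ≠ 0) fun z => by
    have e1 : (Fintype.card {e : Sym2 (Fin (M * m)) // e.map f = z} : ℝ) ≤ m ^ 2 := by
      exact_mod_cast card_fiber_sym2_map_le hfm z
    calc (2 * j * δ) ^ 2 * (Fintype.card {e : Sym2 (Fin (M * m)) // e.map f = z} : ℝ)
        ≤ (2 * j * δ) ^ 2 * m ^ 2 := by gcongr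
      _ = (2 * j * δ * m) ^ 2 := by ring
      _ ≤ 1 := pow_le_one₀ (by positivity) hδ
  have hΛ : ∀ φ : SimpleGraph (Fin (M * m)) → ℝ, (∀ G, φ G ∈ Set.Icc (0 : ℝ) 1) →
      ∀ b, ∑ h, κ.law b h * φ (bitGraph h) ∈ Set.Icc (0 : ℝ) 1 := by
    intro φ hφ b
    refine ⟨Finset.sum_nonneg fun h _ => mul_nonneg (κ.law_nonneg b h) (hφ _).1, ?_⟩
    exact (Finset.sum_le_sum fun h _ => mul_le_of_le_one_right (κ.law_nonneg b h)
      (hφ _).2).trans_eq (κ.sum_law b)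
  -- The embedding is chosen for the tests averaged over the block laws; the blocks are fixed
  -- afterwards, for that embedding.
  obtain ⟨ι, x, hιx⟩ := exists_embedBits_reduction hkn ht hM hn (hΛ φ₁ h1) (hΛ φ₀ h0)
  obtain ⟨c₁, c₀, hc⟩ := κ.exists_le (erdosRenyi n half) (plantedClique n k half)
    (fun G => embedBits ι x G) (fun h => φ₁ (bitGraph h)) fun h => φ₀ (bitGraph h)
  refine ⟨_, isLocal_bitGraph ι x (Sym2.map f) c₁ c₀, hc.trans (hιx.trans ?_)⟩
  have e1 : ∑ b, bitsProb (fun _ => 1 / 2) b * ∑ h, κ.law b h * φ₁ (bitGraph h) =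
      ∫ G, φ₁ G ∂(erdosRenyi (M * m) half) := by
    rw [κ.sum_bitsProb_law_empty, integral_erdosRenyi half id Function.injective_id.injOn, coe_half]
    rfl
  have e2 : (M.choose k : ℝ)⁻¹ * ∑ T ∈ (Finset.univ : Finset (Fin M)).powersetCard k,
      ∑ b, bitsProb (fun z => if z ∈ T.sym2 then 1 else 1 / 2) b *
        ∑ h, κ.law b h * φ₀ (bitGraph h) ≤
      ∫ G, φ₀ G ∂(plantedDense (M * m) (k * m) p half) + k ^ 2 * (4 / 2 ^ j) := by
    have e3 : ∀ T ∈ (Finset.univ : Finset (Fin M)).powersetCard k,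
        ∑ b, bitsProb (fun z => if z ∈ T.sym2 then 1 else 1 / 2) b *
          ∑ h, κ.law b h * φ₀ (bitGraph h) ≤
        ∑ h, bitsProb (denseProb p (1 / 2) ((groups m T).map g.toEmbedding)) h *
          φ₀ (bitGraph h) + k ^ 2 * (4 / 2 ^ j) := by
      intro T hT
      have hTk := (Finset.mem_powersetCard.1 hT).2
      refine (κ.sum_bitsProb_law_le hpI hη0 hη1 T.sym2 (fun h => (h0 _).1)
        fun h => (h0 _).2).trans (add_le_add (le_of_eq ?_) ?_)
      · have e4 : (fun e => if Sym2.map f e ∈ T.sym2 then 1 / 2 + δ else (1 / 2 : ℝ)) =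
            denseProb p (1 / 2) ((groups m T).map g.toEmbedding) := by
          funext e
          have e5 : Sym2.map f e ∈ T.sym2 ↔ ∀ v ∈ e, v ∈ (groups m T).map g.toEmbedding := by
            have e6 : ∀ v, v ∈ (groups m T).map g.toEmbedding ↔ f v ∈ T := by
              intro v
              obtain ⟨y, rfl⟩ := g.surjective v
              simp [groups, hf]
            simp only [e6]
            rw [Finset.mem_sym2_iff]
            simp only [Sym2.mem_map, forall_exists_index, and_imp, forall_apply_eq_imp_iff₂]
          unfold denseProb
          rw [hp]
          by_cases h5 : Sym2.map f e ∈ T.sym2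
          · rw [if_pos h5, if_pos (e5.1 h5)]
          · rw [if_neg h5, if_neg fun h => h5 (e5.2 h)]
        rw [e4]
      · gcongr
        rw [Finset.card_sym2, hTk]
        -- The planted blocks include the diagonal ones, hence `k + 1`.
        have : (k + 1).choose 2 ≤ k ^ 2 := by
          rw [Nat.choose_two_right, Nat.add_sub_cancel]
          rcases Nat.eq_zero_or_pos k with rfl | hk
          · simp
          · apply Nat.div_le_of_le_mul
            nlinarith
        exact_mod_cast this
    have e7 := mul_le_mul_of_nonneg_left (Finset.sum_le_sum e3)
      (by positivity : (0 : ℝ) ≤ (M.choose k : ℝ)⁻¹)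
    rw [Finset.sum_add_distrib, Finset.sum_const, Finset.card_powersetCard, Finset.card_univ,
      Fintype.card_fin, nsmul_eq_mul, mul_add, inv_mul_cancel_left₀ hcM] at e7
    linarith
  rw [e1]
  linarith

/-! ## Growth exponents -/

/-- `f n = n ^ (c + o(1))`. -/
def HasExponent (f : ℕ → ℝ) (c : ℝ) : Prop :=
  (∀ n, 0 < f n) ∧ Tendsto (fun n : ℕ => Real.log (f n) / Real.log (n + 1)) atTop (𝓝 c)

lemma tendsto_cast_add_one : Tendsto (fun n : ℕ => (n : ℝ) + 1) atTop atTop :=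
  tendsto_atTop_add_const_right _ _ tendsto_natCast_atTop_atTop

lemma tendsto_log_add_one : Tendsto (fun n : ℕ => Real.log (n + 1)) atTop atTop :=
  Real.tendsto_log_atTop.comp tendsto_cast_add_one

lemma HasExponent.mul {f g : ℕ → ℝ} {a b : ℝ} (hf : HasExponent f a) (hg : HasExponent g b) :
    HasExponent (fun n => f n * g n) (a + b) := by
  refine ⟨fun n => mul_pos (hf.1 n) (hg.1 n), (hf.2.add hg.2).congr fun n => ?_⟩
  rw [Real.log_mul (hf.1 n).ne' (hg.1 n).ne', add_div]

lemma hasExponent_const {a : ℝ} (ha : 0 < a) : HasExponent (fun _ => a) 0 :=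
  ⟨fun _ => ha, tendsto_log_add_one.const_div_atTop _⟩

lemma hasExponent_rpow (c : ℝ) : HasExponent (fun n => ((n : ℝ) + 1) ^ c) c := by
  refine ⟨fun n => by positivity, tendsto_const_nhds.congr' ?_⟩
  filter_upwards [tendsto_log_add_one.eventually_gt_atTop 0] with n hn
  rw [Real.log_rpow (by positivity), mul_div_cancel_right₀ _ hn.ne']

lemma hasExponent_add_one : HasExponent (fun n => (n : ℝ) + 1) 1 := by
  simpa using hasExponent_rpow 1

lemma HasExponent.squeeze {f g h : ℕ → ℝ} {a : ℝ} (hf : HasExponent f a) (hh : HasExponent h a)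
    (h1 : ∀ n, f n ≤ g n) (h2 : ∀ n, g n ≤ h n) : HasExponent g a := by
  have hg : ∀ n, 0 < g n := fun n => (hf.1 n).trans_le (h1 n)
  have hL : ∀ n : ℕ, 0 ≤ Real.log ((n : ℝ) + 1) := fun n => Real.log_nonneg (by simp)
  refine ⟨hg, tendsto_of_tendsto_of_tendsto_of_le_of_le hf.2 hh.2 (fun n => ?_) fun n => ?_⟩
  · exact div_le_div_of_nonneg_right (Real.log_le_log (hf.1 n) (h1 n)) (hL n)
  · exact div_le_div_of_nonneg_right (Real.log_le_log (hg n) (h2 n)) (hL n)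

/-- This changes the base from n + 1 to the number of vertices of the constructed problem. -/
lemma HasExponent.div {f g : ℕ → ℝ} {a b : ℝ} (hf : HasExponent f a) (hg : HasExponent g b)
    (hb : b ≠ 0) : Tendsto (fun n => Real.log (f n) / Real.log (g n)) atTop (𝓝 (a / b)) := by
  refine (hf.2.div hg.2 hb).congr' ?_
  filter_upwards [tendsto_log_add_one.eventually_gt_atTop 0] with n hn
  exact div_div_div_cancel_right₀ hn.ne' _ _

lemma ceil_le_two_mul {x : ℝ} (hx : 1 ≤ x) : (⌈x⌉₊ : ℝ) ≤ 2 * x := by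
  have := Nat.ceil_lt_add_one (zero_le_one.trans hx)
  linarith

lemma one_le_rpow_add_one (n : ℕ) {c : ℝ} (hc : 0 ≤ c) : 1 ≤ ((n : ℝ) + 1) ^ c :=
  Real.one_le_rpow (by simp) hc

lemma hasExponent_ceil {c : ℝ} (hc : 0 ≤ c) :
    HasExponent (fun n => (⌈((n : ℝ) + 1) ^ c⌉₊ : ℝ)) c :=
  (hasExponent_rpow c).squeeze
    (by simpa using (hasExponent_const two_pos).mul (hasExponent_rpow c))
    (fun _ => Nat.le_ceil _) fun n => ceil_le_two_mul (one_le_rpow_add_one n hc)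

lemma hasExponent_log : HasExponent (fun n => ((2 * (Nat.log 2 (n + 1) + 1) : ℕ) : ℝ)) 0 := by
  have h2 : 0 < Real.log 2 := Real.log_pos one_lt_two
  have hlog : ∀ n : ℕ, 0 ≤ Real.log ((n : ℝ) + 1) := fun n => Real.log_nonneg (by simp)
  have h : HasExponent (fun n : ℕ => 2 * (Real.log (n + 1) / Real.log 2 + 1)) 0 := by
    have hpos : ∀ n : ℕ, 0 < Real.log ((n : ℝ) + 1) / Real.log 2 + 1 := fun n => by
      have := hlog n
      positivity
    have h3 : HasExponent (fun n : ℕ => Real.log (n + 1) / Real.log 2 + 1) 0 := by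
      refine ⟨hpos, ?_⟩
      have h4 : Tendsto (fun x : ℝ => Real.log (x / Real.log 2 + 1) / x) atTop (𝓝 0) := by
        have h5 : Tendsto (fun x : ℝ => x / Real.log 2 + 1) atTop atTop :=
          tendsto_atTop_add_const_right _ _ (tendsto_id.atTop_div_const h2)
        have h6 := (Real.isLittleO_log_id_atTop.tendsto_div_nhds_zero).comp h5
        have h7 : Tendsto (fun x : ℝ => (Real.log 2)⁻¹ + 1 / x) atTop (𝓝 ((Real.log 2)⁻¹ + 0)) :=
          tendsto_const_nhds.add (tendsto_const_nhds.div_atTop tendsto_id)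
        have h8 := h6.mul h7
        rw [zero_mul] at h8
        refine h8.congr' ?_
        filter_upwards [eventually_gt_atTop 0] with x hx
        have : x / Real.log 2 + 1 ≠ 0 := by positivity
        simp only [Function.comp, id]
        field_simp
      exact h4.comp tendsto_log_add_one
    simpa using (hasExponent_const two_pos).mul h3
  refine (hasExponent_const two_pos).squeeze h (fun n => ?_) fun n => ?_
  · push_cast
    have : (0 : ℝ) ≤ Nat.log 2 (n + 1) := by positivity
    linarith
  · push_cast
    gcongr
    rw [le_div_iff₀ h2, ← Real.log_pow]
    apply Real.log_le_log (by positivity)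
    exact_mod_cast Nat.pow_log_le_self 2 n.succ_ne_zero

lemma tendsto_rpow_add_one {c : ℝ} (hc : c < 0) :
    Tendsto (fun n : ℕ => ((n : ℝ) + 1) ^ c) atTop (𝓝 0) := by
  have := (tendsto_rpow_neg_atTop (y := -c) (by linarith)).comp tendsto_cast_add_one
  simpa [Function.comp_def] using this

/-- In powers of n, the group size is n^c, the bias n^(-(c + d)), the clique size n^κ, the number of
vertices n^(1 + c); the two equations fix the regime. Solving for d and κ, the constraint d ≥ 0
means c(1 - α) ≤ α, κ < 1/2 means c > (β - 1/2) / (1 - β), and κ > 0 means c < β / (1 - β). For α <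
1 the first two are compatible precisely because β < 1/2 + α/2. -/
lemma exists_exponents {α β : ℝ} (hα : 0 ≤ α) (hβ0 : 0 < β) (hβ1 : β < 1)
    (h : β < 1 / 2 + α / 2) : ∃ c d κ : ℝ, 0 ≤ c ∧ 0 ≤ d ∧ 0 < κ ∧ κ < 1 / 2 ∧
      c + d = α * (1 + c) ∧ κ + c = β * (1 + c) := by
  rcases lt_or_ge β (1 / 2) with hβ | hβ
  -- For β < 1/2 the group size stays bounded and only the density is lowered.
  · exact ⟨0, α, β, le_rfl, hα, hβ0, hβ, by ring, by ring⟩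
  have hb : 0 < 1 - β := by linarith
  have h0 : (β - 1 / 2) / (1 - β) < β / (1 - β) := by gcongr; linarith
  obtain ⟨c, hc0, hc1, hc2⟩ : ∃ c, (β - 1 / 2) / (1 - β) < c ∧ c < β / (1 - β) ∧
      c * (1 - α) ≤ α := by
    rcases lt_or_ge α 1 with hα1 | hα1
    · have ha : 0 < 1 - α := by linarith
      have h1 : (β - 1 / 2) / (1 - β) < α / (1 - α) := by
        rw [div_lt_div_iff₀ hb ha]
        nlinarith
      obtain ⟨c, hc0, hc1⟩ := exists_between (lt_min h0 h1)
      rw [lt_min_iff] at hc1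
      exact ⟨c, hc0, hc1.1, ((lt_div_iff₀ ha).1 hc1.2).le⟩
    · obtain ⟨c, hc0, hc1⟩ := exists_between h0
      have : 0 ≤ c := (div_nonneg (by linarith) hb.le).trans hc0.le
      exact ⟨c, hc0, hc1, by nlinarith⟩
  have hc : 0 ≤ c := (div_nonneg (by linarith) hb.le).trans hc0.le
  rw [div_lt_iff₀ hb] at hc0
  rw [lt_div_iff₀ hb] at hc1
  exact ⟨c, α * (1 + c) - c, β * (1 + c) - c, hc, by linarith, by linarith, by linarith,
    by ring, by ring⟩

/-- The logarithm to the base `n` has the same limit as the one to the base `n + 1`. -/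
lemma HasExponent.tendsto_logb {f : ℕ → ℝ} {a : ℝ} (hf : HasExponent f a) :
    Tendsto (fun n : ℕ => Real.logb n (f n)) atTop (𝓝 a) := by
  have hlog : Tendsto (fun n : ℕ => Real.log n) atTop atTop :=
    Real.tendsto_log_atTop.comp tendsto_natCast_atTop_atTop
  have h1 : Tendsto (fun n : ℕ => Real.log (n + 1) / Real.log n) atTop (𝓝 1) := by
    have h2 : Tendsto (fun n : ℕ => 1 + Real.log 2 / Real.log n) atTop (𝓝 (1 + 0)) :=
      tendsto_const_nhds.add (hlog.const_div_atTop _)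
    rw [add_zero] at h2
    refine tendsto_of_tendsto_of_tendsto_of_le_of_le' tendsto_const_nhds h2 ?_ ?_
    · filter_upwards [eventually_ge_atTop 2] with n hn
      have hn' : (2 : ℝ) ≤ n := by exact_mod_cast hn
      rw [one_le_div (Real.log_pos (by linarith))]
      exact Real.log_le_log (by linarith) (by linarith)
    · filter_upwards [eventually_ge_atTop 2] with n hn
      have hn' : (2 : ℝ) ≤ n := by exact_mod_cast hn
      have h0 : 0 < Real.log n := Real.log_pos (by linarith)
      rw [div_le_iff₀ h0, add_mul, div_mul_cancel₀ _ h0.ne', one_mul,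
        ← Real.log_mul (by linarith) two_ne_zero]
      exact Real.log_le_log (by linarith) (by linarith)
  have h3 := hf.2.mul h1
  rw [mul_one] at h3
  refine h3.congr' ?_
  filter_upwards [tendsto_log_add_one.eventually_gt_atTop 0] with n hn
  rw [div_mul_div_cancel₀ hn.ne', Real.logb]

lemma ceil_rpow_le_pow (n : ℕ) (c : ℝ) : ⌈((n : ℝ) + 1) ^ c⌉₊ ≤ (n + 1) ^ ⌈c⌉₊ := by
  rw [Nat.ceil_le]
  push_cast
  rw [← Real.rpow_natCast]
  exact Real.rpow_le_rpow_of_exponent_le (by simp) (Nat.le_ceil c)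

/-! ### Transfer of running times and of error bounds. -/

lemma polynomial_eval_mono (P : Polynomial ℕ) : Monotone fun x => P.eval x := by
  intro x y h
  simp only [Polynomial.eval_eq_sum_range]
  gcongr

lemma IsPolyTime.of_overhead {N : ℕ → ℕ} {A A' : ℕ → Prog} (hA : IsPolyTime N A)
    {Q : Polynomial ℕ} (hQ : ∀ n, N n ≤ Q.eval n)
    (h : ∀ n, (A' n).length ≤ (A n).length + 100 * (N n + 1) ^ 3 ∧
      ∀ T, (∀ H : SimpleGraph (Fin (N n)), HaltsWithin (A n) H T) →
        ∀ G : SimpleGraph (Fin n), HaltsWithin (A' n) G (T + 100 * (N n + 1) ^ 3)) :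
    IsPolyTime (fun n => n) A' := by
  obtain ⟨P, hP⟩ := hA
  refine ⟨P.comp Q + 100 * (Q + 1) ^ 3, fun n => ?_⟩
  have h1 : P.eval (N n) + 100 * (N n + 1) ^ 3 ≤ (P.comp Q + 100 * (Q + 1) ^ 3).eval n := by
    simp only [Polynomial.eval_add, Polynomial.eval_mul, Polynomial.eval_pow, Polynomial.eval_comp,
      Polynomial.eval_one, Polynomial.eval_ofNat]
    have h2 := polynomial_eval_mono P (hQ n)
    have h3 := hQ n
    dsimp only at h2
    gcongr
  exact ⟨((h n).1.trans (Nat.add_le_add_right (hP n).1 _)).trans h1,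
    fun G => ((h n).2 _ (hP n).2 G).mono h1⟩

lemma one_le_liminf_of_le_add {a b e : ℕ → ℝ≥0∞} (ha : 1 ≤ liminf a atTop)
    (he : Tendsto e atTop (𝓝 0)) (h : ∀ᶠ n in atTop, a n ≤ b n + e n) :
    1 ≤ liminf b atTop := by
  refine le_of_forall_lt_imp_le_of_dense fun x hx => ?_
  obtain ⟨y, hxy, hy⟩ := exists_between hx
  refine le_liminf_of_le (by isBoundedDefault) ?_
  filter_upwards [eventually_lt_of_lt_liminf (hy.trans_le ha), h,
    he.eventually_lt_const (tsub_pos_of_lt hxy)] with n h1 h2 h3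
  by_contra! h4
  have h5 : y < y := calc
    y < b n + e n := h1.trans_le h2
    _ ≤ x + (y - x) := add_le_add h4.le h3.le
    _ = y := add_tsub_cancel_of_le hxy.le
  exact h5.false

/-! ## Hardness below the boundary -/

/-- With t = (n + 1)^θ, the diagonal concentrates because θ > 1/2, and the change of measure is
harmless because κ + θ < 1. The block error vanishes because 2^j ≥ (n + 1)² exceeds the order of k².
-/
lemma tendsto_reductionError {κ θ : ℝ} (hκ : 0 < κ) (hθ : 1 / 2 < θ)
    (hκθ : κ + θ < 1) :
    Tendsto (fun n : ℕ => 2 * (⌈((n : ℝ) + 1) ^ κ⌉₊ : ℝ) *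
        (((n : ℝ) + 1) ^ θ + (⌈((n : ℝ) + 1) ^ κ⌉₊ : ℝ)) / ((4 * (n + 1) : ℕ) : ℝ) +
        3 * (((4 * (n + 1) : ℕ) : ℝ) / (4 * (((n : ℝ) + 1) ^ θ) ^ 2)) +
        (⌈((n : ℝ) + 1) ^ κ⌉₊ : ℝ) ^ 2 * (4 / 2 ^ (2 * (Nat.log 2 (n + 1) + 1))))
      atTop (𝓝 0) := by
  have hlim : Tendsto (fun n : ℕ => (((n : ℝ) + 1) ^ (κ + θ - 1) +
      2 * ((n : ℝ) + 1) ^ (2 * κ - 1)) + 3 * ((n : ℝ) + 1) ^ (1 - 2 * θ) +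
      16 * ((n : ℝ) + 1) ^ (2 * κ - 2)) atTop (𝓝 0) := by
    have := (((tendsto_rpow_add_one (c := κ + θ - 1) (by linarith)).add
      ((tendsto_rpow_add_one (c := 2 * κ - 1) (by linarith)).const_mul 2)).add
      ((tendsto_rpow_add_one (c := 1 - 2 * θ) (by linarith)).const_mul 3)).add
      ((tendsto_rpow_add_one (c := 2 * κ - 2) (by linarith)).const_mul 16)
    simpa using this
  refine squeeze_zero (fun n => by positivity) (fun n => ?_) hlim
  have hx : (0 : ℝ) < (n : ℝ) + 1 := by positivity
  have hk := ceil_le_two_mul (one_le_rpow_add_one n hκ.le)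
  have hpow : ((n : ℝ) + 1) ^ 2 ≤ 2 ^ (2 * (Nat.log 2 (n + 1) + 1)) := by
    have h1 := Nat.lt_pow_succ_log_self one_lt_two (n + 1)
    have h2 : ((n + 1 : ℕ) : ℝ) ≤ 2 ^ (Nat.log 2 (n + 1) + 1) := by exact_mod_cast h1.le
    rw [mul_comm, pow_mul]
    push_cast at h2
    gcongr
  have e1 : ((n : ℝ) + 1) ^ (κ + θ - 1) =
      ((n : ℝ) + 1) ^ κ * ((n : ℝ) + 1) ^ θ / ((n : ℝ) + 1) := by
    rw [Real.rpow_sub hx, Real.rpow_add hx, Real.rpow_one]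
  have e2 : ((n : ℝ) + 1) ^ (2 * κ - 1) = (((n : ℝ) + 1) ^ κ) ^ 2 / ((n : ℝ) + 1) := by
    rw [Real.rpow_sub hx, mul_comm, Real.rpow_mul hx.le, Real.rpow_one, Real.rpow_two]
  have e3 : ((n : ℝ) + 1) ^ (1 - 2 * θ) = ((n : ℝ) + 1) / (((n : ℝ) + 1) ^ θ) ^ 2 := by
    rw [Real.rpow_sub hx, mul_comm 2, Real.rpow_mul hx.le, Real.rpow_one, Real.rpow_two]
  have e4 : ((n : ℝ) + 1) ^ (2 * κ - 2) = (((n : ℝ) + 1) ^ κ) ^ 2 / ((n : ℝ) + 1) ^ 2 := by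
    rw [Real.rpow_sub hx, mul_comm, Real.rpow_mul hx.le, Real.rpow_two, Real.rpow_two]
  rw [e1, e2, e3, e4]
  push_cast
  have hy : 0 < ((n : ℝ) + 1) ^ κ := by positivity
  generalize ((n : ℝ) + 1) ^ κ = y at *
  have hz : 0 < ((n : ℝ) + 1) ^ θ := by positivity
  generalize ((n : ℝ) + 1) ^ θ = z at *
  generalize (n : ℝ) + 1 = x at *
  gcongr ?_ + ?_ + ?_
  · calc 2 * (⌈y⌉₊ : ℝ) * (z + ⌈y⌉₊) / (4 * x) ≤ 2 * (2 * y) * (z + 2 * y) / (4 * x) := by gcongr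
      _ = _ := by field_simp; ring
  · apply le_of_eq
    field_simp
  · calc (⌈y⌉₊ : ℝ) ^ 2 * (4 / 2 ^ (2 * (Nat.log 2 (n + 1) + 1))) ≤ (2 * y) ^ 2 * (4 / x ^ 2) := by
          gcongr
      _ = _ := by ring

lemma eventually_ceil_rpow_le {κ : ℝ} (hκ : 0 < κ) (hκ2 : κ < 1) :
    ∀ᶠ n : ℕ in atTop, ⌈((n : ℝ) + 1) ^ κ⌉₊ ≤ n := by
  filter_upwards [(tendsto_rpow_add_one (c := κ - 1) (by linarith)).eventually_lt_const
    (show (0 : ℝ) < 1 / 4 by norm_num), eventually_ge_atTop 1] with n h1 h2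
  have hx : (0 : ℝ) < (n : ℝ) + 1 := by positivity
  have h2' : (1 : ℝ) ≤ n := by exact_mod_cast h2
  rw [Real.rpow_sub hx, Real.rpow_one, div_lt_iff₀ hx] at h1
  have := ceil_le_two_mul (one_le_rpow_add_one n hκ.le)
  rw [← Nat.cast_le (α := ℝ)]
  linarith

/-- A test for planted dense subgraphs yields a test for planted cliques. -/
lemma exists_prog_of_reduction {n k M m j : ℕ} {δ t : ℝ} (ht : 0 < t)
    (hM : 0 < M) (hn : (n : ℝ) ≤ M / 2 - t) (hδ0 : 0 ≤ δ) (hj : 2 ≤ j) (hm : 0 < m)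
    (hδ : 2 * j * δ * m ≤ 1) {p : I} (hp : (p : ℝ) = 1 / 2 + δ) (A : Prog) :
    ∃ A' : Prog, A'.length ≤ A.length + 100 * (M * m + 1) ^ 3 ∧
      (∀ T, (∀ H : SimpleGraph (Fin (M * m)), HaltsWithin A H T) →
        ∀ G : SimpleGraph (Fin n), HaltsWithin A' G (T + 100 * (M * m + 1) ^ 3)) ∧
      (k ≤ n → errorPC n k half A' ≤ errorPDS (M * m) (k * m) p half A +
        ENNReal.ofReal (2 * k * (t + k) / M + 3 * (M / (4 * t ^ 2)) + k ^ 2 * (4 / 2 ^ j))) := by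
  have hnN : n ≤ M * m := by
    have : (0 : ℝ) ≤ M := by positivity
    have : n ≤ M := by
      rw [← Nat.cast_le (α := ℝ)]
      linarith
    exact this.trans (Nat.le_mul_of_pos_right _ hm)
  by_cases hkn : k ≤ n
  · obtain ⟨F, hF, hle⟩ := exists_local_reduction hkn ht hM hn hδ0 hj hm hδ hp
      (φ₁ := outputReal A true) (φ₀ := outputReal A false)
      (fun G => ⟨outputReal_nonneg _ _ _, outputReal_le_one _ _ _⟩)
      (fun G => ⟨outputReal_nonneg _ _ _, outputReal_le_one _ _ _⟩)
    obtain ⟨A', hl, hh, ho⟩ := hF.exists_prog hnN A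
    refine ⟨A', hl, fun T hT G => hh G T (hT _), fun _ => ?_⟩
    have ho' : ∀ b, (fun G => outputReal A' b G) = fun G => outputReal A b (F G) := fun b => by
      funext G
      rw [outputReal, ho, outputReal]
    rw [errorPC, errorPDS, testError_eq, testError_eq, ho', ho']
    exact (ENNReal.ofReal_le_ofReal hle).trans ENNReal.ofReal_add_le
  -- For `k > n` no error bound is claimed; the constant map merely supplies a program within the
  -- resource bounds.
  · have hF : IsLocal fun _ : SimpleGraph (Fin n) => (⊥ : SimpleGraph (Fin (M * m))) :=
      fun i j => Or.inl ⟨False, by simp⟩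
    obtain ⟨A', hl, hh, -⟩ := hF.exists_prog hnN A
    exact ⟨A', hl, fun T hT G => hh G T (hT _), fun h => absurd h hkn⟩

/-- The sequence is the image of the planted clique problems of size n^κ under the reduction,
indexed by the clique instance size n. -/
theorem exists_denseRegime_of_lt {α β : ℝ} (hα : 0 ≤ α) (hβ0 : 0 < β) (hβ1 : β < 1)
    (h : β < 1 / 2 + α / 2) : ∃ (N K : ℕ → ℕ) (p q : ℕ → I), DenseRegime α β N K p q ∧
      (PCConjecture half → ∀ A : ℕ → Prog, IsPolyTime N A →
        1 ≤ liminf (fun n => errorPDS (N n) (K n) (p n) (q n) (A n)) atTop) := by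
  obtain ⟨c, d, κ, hc, hd, hκ, hκ2, hcd, hκc⟩ := exists_exponents hα hβ0 hβ1 h
  set k : ℕ → ℕ := fun n => ⌈((n : ℝ) + 1) ^ κ⌉₊ with hk
  set m : ℕ → ℕ := fun n => ⌈((n : ℝ) + 1) ^ c⌉₊ with hm
  set j : ℕ → ℕ := fun n => 2 * (Nat.log 2 (n + 1) + 1) with hj
  -- Half of this is 2(n + 1), which leaves room for n vertices after subtracting t ≤ n + 1.
  set M : ℕ → ℕ := fun n => 4 * (n + 1) with hM
  -- The bias is `δ = (D n)⁻¹`: the factor `2 * m * j` gives the condition `2 * j * δ * m ≤ 1`, and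
  -- the power of exponent `d` weakens the signal further to the prescribed α.
  set D : ℕ → ℝ := fun n => 2 * m n * j n * ((n : ℝ) + 1) ^ d with hD
  have ek : HasExponent (fun n => (k n : ℝ)) κ := hasExponent_ceil hκ.le
  have em : HasExponent (fun n => (m n : ℝ)) c := hasExponent_ceil hc
  have eM : HasExponent (fun n => (M n : ℝ)) 1 := by
    simpa [hM] using (hasExponent_const four_pos).mul hasExponent_add_one
  have eN : HasExponent (fun n => ((M n * m n : ℕ) : ℝ)) (1 + c) := by
    simpa using eM.mul em
  have eK : HasExponent (fun n => ((k n * m n : ℕ) : ℝ)) (κ + c) := by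
    simpa using ek.mul em
  have eD : HasExponent D (c + d) := by
    have := (((hasExponent_const two_pos).mul em).mul hasExponent_log).mul (hasExponent_rpow d)
    rwa [zero_add, add_zero] at this
  have hmpos : ∀ n, 0 < m n := fun n => Nat.cast_pos.1 (em.1 n)
  have hkpos : ∀ n, 0 < k n := fun n => Nat.cast_pos.1 (ek.1 n)
  have hj2 : ∀ n, 2 ≤ j n := fun n => by simp only [hj]; omega
  have hD2 : ∀ n, 2 ≤ D n := fun n => by
    have h1 : (1 : ℝ) ≤ m n := by exact_mod_cast hmpos n
    have h2 : (1 : ℝ) ≤ j n := by exact_mod_cast one_le_two.trans (hj2 n)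
    have h3 := one_le_rpow_add_one n hd
    have h4 : (1 : ℝ) ≤ m n * j n := one_le_mul_of_one_le_of_one_le h1 h2
    have h5 := one_le_mul_of_one_le_of_one_le h4 h3
    simp only [hD]
    nlinarith
  have hδ0 : ∀ n, 0 < (D n)⁻¹ := fun n => inv_pos.2 (eD.1 n)
  have hδ1 : ∀ n, (D n)⁻¹ ≤ 1 / 2 := fun n => by
    rw [one_div]
    exact inv_anti₀ two_pos (hD2 n)
  have hδ : ∀ n, 2 * j n * (D n)⁻¹ * m n ≤ 1 := fun n => by
    have h1 := eD.1 n
    rw [mul_right_comm, ← div_eq_mul_inv, div_le_one h1]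
    have h2 : (0 : ℝ) ≤ 2 * m n * j n := by positivity
    have := le_mul_of_one_le_right h2 (one_le_rpow_add_one n hd)
    simp only [hD]
    linarith
  have hpI : ∀ n, 1 / 2 + (D n)⁻¹ ∈ I := fun n =>
    ⟨by linarith [hδ0 n], by linarith [hδ1 n]⟩
  set p : ℕ → I := fun n => ⟨1 / 2 + (D n)⁻¹, hpI n⟩ with hp
  have hpv : ∀ n, (p n : ℝ) = 1 / 2 + (D n)⁻¹ := fun n => rfl
  have hc1 : 1 + c ≠ 0 := by positivity
  have hkM : ∀ n, k n ≤ M n := fun n => by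
    have h1 : k n ≤ n + 1 := by
      rw [hk, Nat.ceil_le]
      push_cast
      calc ((n : ℝ) + 1) ^ κ ≤ ((n : ℝ) + 1) ^ (1 : ℝ) :=
            Real.rpow_le_rpow_of_exponent_le (by simp) (by linarith)
        _ = _ := Real.rpow_one _
    simp only [hM]
    omega
  refine ⟨fun n => M n * m n, fun n => k n * m n, p, fun _ => half, ?_, ?_⟩
  · refine ⟨?_, fun n => Nat.mul_le_mul_right _ (hkM n), fun n => ?_,
      ⟨1 / 2, by norm_num, fun n => le_of_eq rfl⟩, ?_, ?_⟩
    · refine tendsto_atTop_mono (fun n => ?_) tendsto_id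
      calc n ≤ M n := by simp only [hM]; omega
        _ ≤ M n * m n := Nat.le_mul_of_pos_right _ (hmpos n)
    · rw [← Subtype.coe_lt_coe, hpv, coe_half]
      linarith [hδ0 n]
    · have := eD.div eN hc1
      rw [(div_eq_iff hc1).2 hcd] at this
      refine this.congr fun n => ?_
      rw [hpv, coe_half, add_sub_cancel_left, inv_inv]
    · have := eK.div eN hc1
      rwa [(div_eq_iff hc1).2 hκc] at this
  · intro hPC A hA
    -- The midpoint of the admissible interval (1/2, 1 - κ).
    set θ : ℝ := 3 / 4 - κ / 2 with hθ
    have ht : ∀ n : ℕ, 0 < ((n : ℝ) + 1) ^ θ := fun n => by positivity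
    have htn : ∀ n : ℕ, (n : ℝ) ≤ M n / 2 - ((n : ℝ) + 1) ^ θ := fun n => by
      have : ((n : ℝ) + 1) ^ θ ≤ ((n : ℝ) + 1) ^ (1 : ℝ) :=
        Real.rpow_le_rpow_of_exponent_le (by simp) (by linarith)
      rw [Real.rpow_one] at this
      simp only [hM]
      push_cast
      linarith [(Nat.cast_nonneg n : (0 : ℝ) ≤ n)]
    choose A' hl hh he using fun n => exists_prog_of_reduction (k := k n) (ht n)
      (show 0 < M n by simp [hM]) (htn n) (hδ0 n).le (hj2 n) (hmpos n) (hδ n) (hpv n) (A n)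
    have hA' : IsPolyTime (fun n => n) A' := by
      refine hA.of_overhead (Q := 4 * (Polynomial.X + 1) * (Polynomial.X + 1) ^ ⌈c⌉₊)
        (fun n => ?_) fun n => ⟨hl n, hh n⟩
      simp only [Polynomial.eval_mul, Polynomial.eval_pow, Polynomial.eval_add, Polynomial.eval_X,
        Polynomial.eval_one, Polynomial.eval_ofNat]
      exact Nat.mul_le_mul_left _ (ceil_rpow_le_pow n c)
    have hlim : limsup (fun n : ℕ => (Real.logb n (k n) : EReal)) atTop <
        ((1 / 2 : ℝ) : EReal) := by
      refine ((continuous_coe_real_ereal.tendsto κ).comp ek.tendsto_logb).limsup_eq.trans_lt ?_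
      exact_mod_cast hκ2
    have hε := ENNReal.tendsto_ofReal
      (tendsto_reductionError hκ (θ := θ) (by linarith) (by linarith))
    rw [ENNReal.ofReal_zero] at hε
    refine one_le_liminf_of_le_add (hPC A' k hA' hkpos hlim) hε ?_
    filter_upwards [eventually_ceil_rpow_le hκ (by linarith)] with n hn
    exact he n hn

end PlantedDense

end

theorem mainTheorem4 (α β : ℝ) (hα : α ∈ Set.Ico (0 : ℝ) 2) (hβ : β ∈ Set.Ioo (0 : ℝ) 1) :
    -- below the boundary: hardness under the planted clique conjecture at density 1/2
    (β < 1 / 2 + α / 2 →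
      ∃ (N K : ℕ → ℕ) (p q : ℕ → unitInterval),
        PlantedDense.DenseRegime α β N K p q ∧
        (PlantedDense.PCConjecture PlantedDense.half →
          ∀ A : ℕ → PlantedDense.Prog, PlantedDense.IsPolyTime N A →
            1 ≤ liminf (fun n => PlantedDense.errorPDS (N n) (K n) (p n) (q n) (A n)) atTop)) ∧
    -- above the boundary: every problem in the regime is solved in polynomial time
    (1 / 2 + α / 2 < β →
      ∀ (N K : ℕ → ℕ) (p q : ℕ → unitInterval),
        PlantedDense.DenseRegime α β N K p q →
        ∃ A : ℕ → PlantedDense.Prog, PlantedDense.IsPolyTime N A ∧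
          limsup (fun n => PlantedDense.errorPDS (N n) (K n) (p n) (q n) (A n)) atTop = 0) :=
  ⟨fun h => PlantedDense.exists_denseRegime_of_lt hα.1 hβ.1 hβ.2 h,
    fun h _ _ _ _ hR => PlantedDense.exists_isPolyTime_of_lt hβ.1 h hR⟩
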